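/- Let $N\ge 3$ and let $|\psi\rangle$ be a (normalized) pure state of $N$ qubits labelled $A,B,C_1,\dots,C_{N-2}$. For two distinct qubits $X,Y$ let $\rho_{XY}$ be the reduced density matrix of $|\psi\rangle\langle\psi|$ obtained by tracing out all qubits except $X$ and $Y$. The concurrence of a bipartite pure state is $C(|\phi\rangle_{XY})=\sqrt{2\,[1-\mathrm{Tr}(\rho_X^2)]}$, where $\rho_X=\mathrm{Tr}_Y(|\phi\rangle\langle\phi|)$; for a bipartite mixed state $\rho$, the concurrence $C(\rho)$ and the concurrence of assistance $C_a(\rho)$ are respectively the minimum and the maximum of $\sum_k p_k\,C(|\phi_k\rangle)$ over all pure state decompositions $\rho=\sum_k p_k|\phi_k\rangle\langle\phi_k|$ into finitely many unit vectors with $p_k\ge 0$, $\sum_k p_k=1$. Let $C(|\psi\rangle_{ABC_1|C_2\dots C_{N-2}})$ be the concurrence of $|\psi\rangle$ viewed as a bipartite pure state with parties $ABC_1$ and $C_2\dots C_{N-2}$ (for $N=3$ the second party is trivial and this concurrence is $0$). Then $$C^2(|\psi\rangle_{ABC_1|C_2\dots C_{N-2}})\ \ge\ C^2(\rho_{AC_1})+C^2(\rho_{BC_1})+\sum_{i=2}^{N-2}C^2(\rho_{C_1C_i})-2C_a^2(\rho_{AB})-\sum_{i=1}^{N-2}\bigl(C_a^2(\rho_{AC_i})+C_a^2(\rho_{BC_i})\bigr)$$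 and $$C^2(|\psi\rangle_{ABC_1|C_2\dots C_{N-2}})\ \le\ 2C_a^2(\rho_{AB})+\sum_{i=1}^{N-2}\bigl(C_a^2(\rho_{AC_i})+C_a^2(\rho_{BC_i})\bigr)+\sum_{j\in J}C_a^2(\rho_{C_1j}),$$ where $J=\{A,B,C_2,\dots,C_{N-2}\}$. -/

import Mathlib

open scoped BigOperators

noncomputable section

/-- The operator `|ψ⟩⟨ψ|` as a matrix in the standard basis. -/
def pureDensity {α : Type*} [Fintype α] (ψ : EuclideanSpace ℂ α) : Matrix α α ℂ :=
  Matrix.of fun x y => ψ x * star (ψ y)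

/-- The partial trace over the second tensor factor. -/
def traceOutRight {α β : Type*} [Fintype β] (ρ : Matrix (α × β) (α × β) ℂ) : Matrix α α ℂ :=
  Matrix.of fun a a' => ∑ b, ρ (a, b) (a', b)

/-- The concurrence `√(2 (1 - Tr ρ_A²))` of a bipartite vector, where `ρ_A` is its reduced density
matrix on the first factor. (`Tr ρ_A²` is a real number.) -/
def pureConcurrence {α β : Type*} [Fintype α] [Fintype β]
    (ψ : EuclideanSpace ℂ (α × β)) : ℝ :=
  Real.sqrt (2 * (1 - (Matrix.trace
    (traceOutRight (pureDensity ψ) * traceOutRight (pureDensity ψ))).re))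

/-- The weights `p i` and the unit vectors `φ i` form a pure state decomposition
`ρ = ∑ i, p i |φ i⟩⟨φ i|`. -/
structure IsPureDecomposition {α : Type*} [Fintype α] (ρ : Matrix α α ℂ) {k : ℕ}
    (p : Fin k → ℝ) (φ : Fin k → EuclideanSpace ℂ α) : Prop where
  nonneg : ∀ i, 0 ≤ p i
  sum_eq_one : ∑ i, p i = 1
  norm_eq_one : ∀ i, ‖φ i‖ = 1
  eq_sum : ρ = ∑ i, (p i : ℂ) • pureDensity (φ i)

/-- The set of all average concurrences `∑ i, p i * C(φ i)` over the pure state decompositions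
(of any finite length) of a bipartite density matrix. -/
def averageConcurrences {α β : Type*} [Fintype α] [Fintype β]
    (ρ : Matrix (α × β) (α × β) ℂ) : Set ℝ :=
  {c | ∃ (k : ℕ) (p : Fin k → ℝ) (φ : Fin k → EuclideanSpace ℂ (α × β)),
    IsPureDecomposition ρ p φ ∧ c = ∑ i, p i * pureConcurrence (φ i)}

/-- The concurrence of a bipartite mixed state (convex roof): the least average concurrence. -/
def mixedConcurrence {α β : Type*} [Fintype α] [Fintype β]
    (ρ : Matrix (α × β) (α × β) ℂ) : ℝ :=
  sInf (averageConcurrences ρ)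

/-- The concurrence of assistance of a bipartite mixed state: the greatest average concurrence. -/
def concurrenceOfAssistance {α β : Type*} [Fintype α] [Fintype β]
    (ρ : Matrix (α × β) (α × β) ℂ) : ℝ :=
  sSup (averageConcurrences ρ)

/-- Vectors of a register of `N` qubits; the basis is labelled by bit strings. -/
abbrev QubitVector (N : ℕ) := EuclideanSpace ℂ (Fin N → Fin 2)

/-- The vector `ψ` viewed as a bipartite vector, with the qubits in `S` as first party and the
remaining qubits as second party. -/
def bipartiteView {N : ℕ} (S : Finset (Fin N)) (ψ : QubitVector N) :
    EuclideanSpace ℂ (({i // i ∈ S} → Fin 2) × ({i // i ∉ S} → Fin 2)) :=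
  WithLp.toLp 2 fun x =>
    ψ ((Equiv.piEquivPiSubtypeProd (fun i => i ∈ S) (fun _ => Fin 2)).symm x)

/-- The concurrence of `ψ` with respect to the partition of the qubits into `S` and its
complement. -/
def cutConcurrence {N : ℕ} (S : Finset (Fin N)) (ψ : QubitVector N) : ℝ :=
  pureConcurrence (bipartiteView S ψ)

/-- The reduced density matrix of the qubits in `S`: all the other qubits are traced out. -/
def reducedDensity {N : ℕ} (S : Finset (Fin N)) (ψ : QubitVector N) :
    Matrix ({i // i ∈ S} → Fin 2) ({i // i ∈ S} → Fin 2) ℂ :=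
  traceOutRight (pureDensity (bipartiteView S ψ))

/-- For distinct `i` and `j`: the bits `(a, b)` as values of the qubits `i` and `j`. -/
def pairBits {N : ℕ} (i j : Fin N) (x : Fin 2 × Fin 2) :
    {k // k ∈ ({i, j} : Finset (Fin N))} → Fin 2 :=
  fun k => if k.1 = i then x.1 else x.2

/-- For distinct `i` and `j`: the two-qubit reduced density matrix `ρ_{ij}`, with the qubit `i` as
first party and the qubit `j` as second party. -/
def pairDensity {N : ℕ} (i j : Fin N) (ψ : QubitVector N) :
    Matrix (Fin 2 × Fin 2) (Fin 2 × Fin 2) ℂ :=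
  (reducedDensity {i, j} ψ).submatrix (pairBits i j) (pairBits i j)

end

/-! Write `T(S) = 2(1 - Tr ρ_S²)`; this is the squared concurrence across the cut between `S` and
the rest (`cutConcurrence_sq`). It is subadditive on disjoint sets (`marginalPurity_add_le`), and
purity of `ψ` gives `T(S) = T(Sᶜ)`. Hence `T(ABC₁) ≤ T(A) + T(B) + T(C₁)`. Applied to `AB` and the
complement of `ABC₁`, subadditivity also gives `T(C₁) ≤ T(AB) + T(ABC₁) ≤ T(A) + T(B) + T(ABC₁)`. It
remains to bound the one-qubit terms by pairwise concurrences.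

From above: expectations of products of the commuting positive operators `1 - swap` show that the
linear mutual information of a qubit is subadditive in its other argument
(`linearMutualInfo_le_sum`). For a pair of qubits it equals the squared Frobenius norm of the Gram
matrix of the determinant form on any decomposition (`linearMutualInfo_pair`). In a Takagi-diagonal
decomposition this is `∑ l²`, at most the squared average concurrence `(∑ l)²`, so it is bounded by
the squared concurrence of assistance.

From below: `T(C₁)` dominates the sum of squared concurrences (`exists_monogamous_decompositions`).
The induction measures one further qubit in a well-chosen basis and joins the decompositions of the
two outcomes. The required two-qubit estimate (`IsEnsemble.exists_measurement`) comes from a Pauli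
normal form of nondegenerate ensembles (`exists_direction_of_diagonal`), extended to all ensembles
by density and compactness. -/

/-! ### Takagi factorization of complex symmetric matrices -/

/-- A conjugate-linear symmetric map has a nonzero vector which it scales by a nonnegative real. -/
theorem exists_conjugate_eigenvector {E : Type*} [NormedAddCommGroup E] [InnerProductSpace ℂ E]
    [FiniteDimensional ℂ E] [Nontrivial E] (T : E →ₛₗ[starRingEnd ℂ] E)
    (hT : ∀ x y, inner ℂ x (T y) = inner ℂ y (T x)) :
    ∃ x : E, ‖x‖ = 1 ∧ ∃ l : ℝ, 0 ≤ l ∧ T x = (l : ℂ) • x := by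
  obtain ⟨x, hx, l, hl, hTx⟩ : ∃ x : E, x ≠ 0 ∧ ∃ l : ℝ, 0 ≤ l ∧ T x = (l : ℂ) • x := by
    obtain ⟨μ, hμ⟩ := Module.End.exists_eigenvalue (T.comp T : E →ₗ[ℂ] E)
    obtain ⟨y, hy⟩ := hμ.exists_hasEigenvector
    have hTT : T (T y) = μ • y := hy.apply_eq_smul
    have hy0 : y ≠ 0 := hy.2
    have hny : (‖y‖ : ℂ) ≠ 0 := by simpa using hy0
    set l : ℝ := ‖T y‖ / ‖y‖ with hl
    have hμl : μ = (l : ℂ) * l := by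
      -- Symmetry at `y` and `T y` reads `μ‖y‖² = ‖T y‖²`, so `μ` is a nonnegative square.
      have h1 := hT y (T y)
      rw [hTT, inner_smul_right, inner_self_eq_norm_sq_to_K, inner_self_eq_norm_sq_to_K] at h1
      rw [hl]
      push_cast
      simp only [Complex.coe_algebraMap] at h1
      field_simp
      linear_combination h1
    have hl0 : 0 ≤ l := by positivity
    -- Since `T² y = l² y`, the vector `T y + l y` is scaled by `l`. If it vanishes then `T y = -l
    -- y`, and conjugate-linearity reverses the sign on `i y`.
    by_cases hz : T y + (l : ℂ) • y = 0
    · refine ⟨Complex.I • y, smul_ne_zero Complex.I_ne_zero hy0, l, hl0, ?_⟩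
      have : T y = -((l : ℂ) • y) := eq_neg_of_add_eq_zero_left hz
      rw [LinearMap.map_smulₛₗ, this, Complex.conj_I, smul_neg, neg_smul, neg_neg, smul_comm]
    · refine ⟨_, hz, l, hl0, ?_⟩
      rw [map_add, LinearMap.map_smulₛₗ, hTT, hμl, Complex.conj_ofReal, smul_add, smul_smul, add_comm]
  have hnx : (‖x‖ : ℂ) ≠ 0 := by simpa using hx
  refine ⟨(‖x‖ : ℂ)⁻¹ • x, ?_, l, hl, ?_⟩
  · rw [norm_smul, norm_inv, Complex.norm_real, norm_norm, inv_mul_cancel₀ (by simpa using hx)]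
  · rw [LinearMap.map_smulₛₗ, hTx, map_inv₀, Complex.conj_ofReal, smul_comm]

/-- The symmetry of `T` makes the orthogonal complement of an eigenvector invariant, so eigenvectors
split off one at a time as in the spectral theorem. -/
theorem exists_orthonormal_conjugate_eigenvectors (n : ℕ) : ∀ {E : Type} [NormedAddCommGroup E]
    [InnerProductSpace ℂ E] [FiniteDimensional ℂ E] (T : E →ₛₗ[starRingEnd ℂ] E)
    (_ : ∀ x y, inner ℂ x (T y) = inner ℂ y (T x)) (_ : Module.finrank ℂ E = n),
    ∃ v : Fin n → E, Orthonormal ℂ v ∧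
      ∃ l : Fin n → ℝ, (∀ i, 0 ≤ l i) ∧ ∀ i, T (v i) = (l i : ℂ) • v i := by
  induction n with
  | zero =>
    intro E _ _ _ T hT hn
    exact ⟨fun i => i.elim0, ⟨fun i => i.elim0, fun i => i.elim0⟩, fun i => i.elim0,
      fun i => i.elim0, fun i => i.elim0⟩
  | succ n ih =>
    intro E _ _ _ T hT hn
    have : Nontrivial E := Module.nontrivial_of_finrank_pos (R := ℂ) (by omega)
    have : Fact (Module.finrank ℂ E = n + 1) := ⟨hn⟩
    obtain ⟨x, hx, a, ha, hTx⟩ := exists_conjugate_eigenvector T hT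
    have hx0 : x ≠ 0 := by rintro rfl; simp at hx
    have hinv : ∀ y ∈ (Submodule.span ℂ {x})ᗮ, T y ∈ (Submodule.span ℂ {x})ᗮ := by
      intro y hy
      rw [Submodule.mem_orthogonal_singleton_iff_inner_right] at hy ⊢
      rw [hT, hTx, inner_smul_right, ← inner_conj_symm, hy]
      simp
    obtain ⟨w, hw, l, hl, hTw⟩ := ih (E := (Submodule.span ℂ {x})ᗮ)
      ((T.domRestrict (Submodule.span ℂ {x})ᗮ).codRestrict _ fun y => hinv y y.2)
      (fun y z => hT y z) (Submodule.finrank_orthogonal_span_singleton hx0)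
    have hxw : ∀ i, inner ℂ x (w i : E) = 0 := fun i =>
      (Submodule.mem_orthogonal_singleton_iff_inner_right.1 (w i).2)
    refine ⟨Fin.cons x fun i => (w i : E), ?_, Fin.cons a l, ?_, ?_⟩
    · rw [orthonormal_iff_ite] at hw ⊢
      intro i j
      refine Fin.cases ?_ (fun i => ?_) i <;> refine Fin.cases ?_ (fun j => ?_) j
      · simp [hx]
      · simp [hxw, (Fin.succ_ne_zero j).symm]
      · rw [← inner_conj_symm]; simp [hxw, Fin.succ_ne_zero]
      · simpa using hw i j
    · intro i
      refine Fin.cases ?_ (fun i => ?_) i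
      · simpa using ha
      · simpa using hl i
    · intro i
      refine Fin.cases ?_ (fun i => ?_) i
      · simpa using hTx
      · exact congrArg Subtype.val (hTw i)

/-- **Takagi factorization**: a complex symmetric matrix is unitarily congruent to a nonnegative
diagonal matrix. -/
theorem Matrix.exists_takagi {n : ℕ} (t : Matrix (Fin n) (Fin n) ℂ) (ht : t.transpose = t) :
    ∃ U ∈ Matrix.unitaryGroup (Fin n) ℂ, ∃ l : Fin n → ℝ, (∀ i, 0 ≤ l i) ∧
      U.transpose * t * U = Matrix.diagonal fun i => (l i : ℂ) := by
  let T : EuclideanSpace ℂ (Fin n) →ₛₗ[starRingEnd ℂ] EuclideanSpace ℂ (Fin n) :=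
    { toFun := fun x => WithLp.toLp 2 fun i => star (∑ j, t i j * x j)
      map_add' := by
        intro x y; ext i; simp [mul_add, Finset.sum_add_distrib]
      map_smul' := by
        intro c x; ext i; simp [Finset.mul_sum, mul_left_comm] }
  have hTa : ∀ x i, T x i = star (∑ j, t i j * x j) := fun _ _ => rfl
  have hT : ∀ x y, inner ℂ x (T y) = inner ℂ y (T x) := by
    intro x y
    simp only [PiLp.inner_apply, RCLike.inner_apply, hTa, star_sum, Finset.sum_mul]
    rw [Finset.sum_comm]
    refine Finset.sum_congr rfl fun i _ => Finset.sum_congr rfl fun j _ => ?_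
    rw [show t j i = t i j from congrFun (congrFun ht i) j]
    simp only [StarMul.star_mul, starRingEnd_apply]; ring
  obtain ⟨v, hv, l, hl, hTv⟩ := exists_orthonormal_conjugate_eigenvectors n T hT (by simp)
  have horth := orthonormal_iff_ite.1 hv
  simp only [PiLp.inner_apply, RCLike.inner_apply] at horth
  refine ⟨Matrix.of fun i k => v k i, ?_, l, hl, ?_⟩
  · rw [Matrix.mem_unitaryGroup_iff']
    ext i j
    have := horth i j
    simp only [Matrix.mul_apply, Matrix.star_apply, Matrix.of_apply, Matrix.one_apply]
    rw [← this]
    exact Finset.sum_congr rfl fun k _ => mul_comm _ _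
  · ext i j
    have hrow : ∀ a, ∑ b, t a b * v j b = l j * star (v j a) := by
      intro a
      have h := congrArg (fun f : EuclideanSpace ℂ (Fin n) => star (f a)) (hTv j)
      simpa [hTa] using h
    rw [Matrix.mul_assoc]
    simp only [Matrix.mul_apply, Matrix.transpose_apply, Matrix.of_apply, hrow]
    have := horth j i
    simp only [Matrix.diagonal_apply]
    calc _ = l j * ∑ a, v i a * star (v j a) := by
          rw [Finset.mul_sum]; exact Finset.sum_congr rfl fun _ _ => by ring
      _ = _ := by
          have h2 : ∑ a, v i a * star (v j a) = if j = i then 1 else 0 := this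
          rw [h2]
          by_cases h : i = j
          · subst h; simp
          · simp [h, Ne.symm h]

/-! ### Ensembles of two-qubit vectors, written as `2 × 2` amplitude matrices -/

/-- `ρ` is the sum of the (unnormalized) pure states with amplitude matrices `X k`. -/
def IsEnsemble {κ : Type*} [Fintype κ] (ρ : Matrix (Fin 2 × Fin 2) (Fin 2 × Fin 2) ℂ)
    (X : κ → Matrix (Fin 2) (Fin 2) ℂ) : Prop :=
  ∀ p q, ρ p q = ∑ k, X k p.1 p.2 * star (X k q.1 q.2)

/-- The symmetric bilinear form polarizing twice the determinant. -/
def detForm (X Y : Matrix (Fin 2) (Fin 2) ℂ) : ℂ :=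
  X 0 0 * Y 1 1 + X 1 1 * Y 0 0 - X 0 1 * Y 1 0 - X 1 0 * Y 0 1

theorem detForm_self (X : Matrix (Fin 2) (Fin 2) ℂ) : detForm X X = 2 * X.det := by
  rw [Matrix.det_fin_two, detForm]; ring

theorem detForm_comm (X Y : Matrix (Fin 2) (Fin 2) ℂ) : detForm X Y = detForm Y X := by
  simp only [detForm]; ring

theorem detForm_sum_left {κ : Type*} (s : Finset κ) (c : κ → ℂ)
    (X : κ → Matrix (Fin 2) (Fin 2) ℂ) (Y : Matrix (Fin 2) (Fin 2) ℂ) :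
    detForm (∑ k ∈ s, c k • X k) Y = ∑ k ∈ s, c k * detForm (X k) Y := by
  simp only [detForm, Matrix.sum_apply, Matrix.smul_apply, smul_eq_mul, Finset.sum_mul,
    ← Finset.sum_add_distrib, ← Finset.sum_sub_distrib]
  exact Finset.sum_congr rfl fun _ _ => by ring

theorem detForm_sum_right {κ : Type*} (s : Finset κ) (c : κ → ℂ)
    (X : κ → Matrix (Fin 2) (Fin 2) ℂ) (Y : Matrix (Fin 2) (Fin 2) ℂ) :
    detForm Y (∑ k ∈ s, c k • X k) = ∑ k ∈ s, c k * detForm Y (X k) := by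
  rw [detForm_comm, detForm_sum_left]
  simp only [detForm_comm]

/-- The matrix of `detForm` on a family of amplitude matrices. -/
def detGram {κ : Type*} (X : κ → Matrix (Fin 2) (Fin 2) ℂ) : Matrix κ κ ℂ :=
  Matrix.of fun i j => detForm (X i) (X j)

/-- The linear combinations of a family of amplitude matrices with the columns of `U` as
coefficients. -/
def mixEnsemble {n : ℕ} (X : Fin n → Matrix (Fin 2) (Fin 2) ℂ) (U : Matrix (Fin n) (Fin n) ℂ) :
    Fin n → Matrix (Fin 2) (Fin 2) ℂ :=
  fun m => ∑ k, U k m • X k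

theorem mixEnsemble_mul {n : ℕ} (X : Fin n → Matrix (Fin 2) (Fin 2) ℂ)
    (U V : Matrix (Fin n) (Fin n) ℂ) :
    mixEnsemble (mixEnsemble X U) V = mixEnsemble X (U * V) := by
  funext m
  simp only [mixEnsemble, Matrix.mul_apply, Finset.smul_sum, Finset.sum_smul, smul_smul]
  rw [Finset.sum_comm]
  exact Finset.sum_congr rfl fun _ _ => Finset.sum_congr rfl fun _ _ => by rw [mul_comm]

/-- The determinant form is bilinear, not sesquilinear: mixing acts by congruence with
`U.transpose`, which is why Takagi factorization replaces spectral diagonalization. -/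
theorem detGram_mixEnsemble {n : ℕ} (X : Fin n → Matrix (Fin 2) (Fin 2) ℂ)
    (U : Matrix (Fin n) (Fin n) ℂ) :
    detGram (mixEnsemble X U) = U.transpose * detGram X * U := by
  ext i j
  simp only [detGram, mixEnsemble, Matrix.of_apply, detForm_sum_left, detForm_sum_right,
    Matrix.mul_apply, Matrix.transpose_apply, Finset.sum_mul, Finset.mul_sum]
  exact Finset.sum_congr rfl fun _ _ => Finset.sum_congr rfl fun _ _ => by ring

/-- This is the unitary freedom of ensembles; only orthonormality of the rows of `U` enters. -/
theorem sum_mixEnsemble_mul_star {n : ℕ} (X : Fin n → Matrix (Fin 2) (Fin 2) ℂ)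
    {U : Matrix (Fin n) (Fin n) ℂ} (hU : U ∈ Matrix.unitaryGroup (Fin n) ℂ) (a b a' b' : Fin 2) :
    ∑ m, mixEnsemble X U m a b * star (mixEnsemble X U m a' b')
      = ∑ k, X k a b * star (X k a' b') := by
  have h := Matrix.mem_unitaryGroup_iff.1 hU
  have h' : ∀ k l, ∑ m, U k m * star (U l m) = if k = l then 1 else 0 := by
    intro k l
    have := congrFun (congrFun h k) l
    simpa [Matrix.mul_apply, Matrix.one_apply] using this
  calc _ = ∑ k, ∑ l, (∑ m, U k m * star (U l m)) * (X k a b * star (X l a' b')) := by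
        simp only [mixEnsemble, Matrix.sum_apply, Matrix.smul_apply, smul_eq_mul, star_sum,
          StarMul.star_mul, Finset.sum_mul, Finset.mul_sum]
        rw [Finset.sum_comm]
        conv_rhs => rw [Finset.sum_comm]
        refine Finset.sum_congr rfl fun k _ => ?_
        rw [Finset.sum_comm]
        exact Finset.sum_congr rfl fun l _ => Finset.sum_congr rfl fun m _ => by ring
    _ = _ := by simp only [h']; simp

theorem IsEnsemble.mix {n : ℕ} {ρ : Matrix (Fin 2 × Fin 2) (Fin 2 × Fin 2) ℂ}
    {X : Fin n → Matrix (Fin 2) (Fin 2) ℂ} (h : IsEnsemble ρ X)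
    {U : Matrix (Fin n) (Fin n) ℂ} (hU : U ∈ Matrix.unitaryGroup (Fin n) ℂ) :
    IsEnsemble ρ (mixEnsemble X U) := by
  intro p q
  rw [sum_mixEnsemble_mul_star X hU, h p q]

/-- Every finite family is Takagi-diagonalized by a unitary mixing. -/
theorem exists_mix_detForm_diagonal {n : ℕ} (X : Fin n → Matrix (Fin 2) (Fin 2) ℂ) :
    ∃ U ∈ Matrix.unitaryGroup (Fin n) ℂ, ∃ l : Fin n → ℝ, (∀ i, 0 ≤ l i) ∧
      detGram (mixEnsemble X U) = Matrix.diagonal fun i => (l i : ℂ) := by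
  obtain ⟨U, hU, l, hl, h⟩ := Matrix.exists_takagi (detGram X)
    (by ext i j; exact detForm_comm _ _)
  exact ⟨U, hU, l, hl, by rw [detGram_mixEnsemble, h]⟩

section
open scoped MatrixOrder ComplexOrder Matrix.Norms.L2Operator

/-- Two-qubit ensembles can be shortened to four vectors. -/
theorem IsEnsemble.exists_fin_four {κ : Type*} [Fintype κ]
    {ρ : Matrix (Fin 2 × Fin 2) (Fin 2 × Fin 2) ℂ} {X : κ → Matrix (Fin 2) (Fin 2) ℂ}
    (h : IsEnsemble ρ X) : ∃ Y : Fin 4 → Matrix (Fin 2) (Fin 2) ℂ, IsEnsemble ρ Y := by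
  let A : Matrix (Fin 2 × Fin 2) κ ℂ := Matrix.of fun p k => X k p.1 p.2
  have hA : ρ = A * A.conjTranspose := by
    ext p q
    rw [h p q]
    simp [A, Matrix.mul_apply]
  have hpos : (0 : Matrix (Fin 2 × Fin 2) (Fin 2 × Fin 2) ℂ) ≤ ρ := by
    -- Positivity yields `ρ = B* B` with a `4 × 4` matrix `B`, whose conjugated rows are the four
    -- vectors.
    rw [Matrix.nonneg_iff_posSemidef, hA]
    exact Matrix.posSemidef_self_mul_conjTranspose A
  obtain ⟨B, hB⟩ := CStarAlgebra.nonneg_iff_eq_star_mul_self.1 hpos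
  let e : Fin 4 ≃ Fin 2 × Fin 2 := (finProdFinEquiv (m := 2) (n := 2)).symm
  refine ⟨fun k => Matrix.of fun a b => star (B (e k) (a, b)), fun p q => ?_⟩
  rw [hB]
  simp only [Matrix.mul_apply, Matrix.star_apply, Matrix.of_apply, star_star]
  exact (Equiv.sum_comp e fun i => star (B i p) * B i q).symm

end

/-! ### Local normal form of a nondegenerate two-qubit ensemble -/

/-- The action `N ↦ ∑ k, X k * N * (X k)ᴴ` of an ensemble. -/
def ensembleMap {κ : Type*} [Fintype κ] (X : κ → Matrix (Fin 2) (Fin 2) ℂ)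
    (N : Matrix (Fin 2) (Fin 2) ℂ) : Matrix (Fin 2) (Fin 2) ℂ :=
  ∑ k, X k * N * (X k).conjTranspose

/-- Polarized Cayley–Hamilton: traceless `Z`, `W` satisfy `Z W + W Z = tr(Z W) • 1`. -/
theorem Matrix.anticommute_of_trace_eq_zero {Z W : Matrix (Fin 2) (Fin 2) ℂ} (hZ : Z.trace = 0)
    (hW : W.trace = 0) (hZW : (Z * W).trace = 0) : Z * W = -(W * Z) := by
  rw [Matrix.trace_fin_two] at hZ hW hZW
  simp only [Matrix.mul_apply, Fin.sum_univ_two] at hZW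
  ext i j
  fin_cases i <;> fin_cases j <;>
    simp only [Matrix.mul_apply, Fin.sum_univ_two, Matrix.neg_apply, Fin.zero_eta, Fin.mk_one]
  · linear_combination hZW + Z 0 0 * hW - W 1 1 * hZ
  · linear_combination Z 0 1 * hW + W 0 1 * hZ
  · linear_combination Z 1 0 * hW + W 1 0 * hZ
  · linear_combination hZW - Z 0 0 * hW + W 1 1 * hZ

theorem Matrix.mul_self_of_trace_eq_zero {Z : Matrix (Fin 2) (Fin 2) ℂ} (hZ : Z.trace = 0) :
    Z * Z = -Z.det • (1 : Matrix (Fin 2) (Fin 2) ℂ) := by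
  rw [Matrix.trace_fin_two] at hZ
  rw [Matrix.det_fin_two]
  ext i j
  fin_cases i <;> fin_cases j <;>
    simp [Matrix.mul_apply, Fin.sum_univ_two]
  · linear_combination Z 0 0 * hZ
  · linear_combination Z 0 1 * hZ
  · linear_combination Z 1 0 * hZ
  · linear_combination Z 1 1 * hZ

/-- Three traceless, mutually trace-orthogonal `2 × 2` matrices with positive determinants are
simultaneously similar to multiples of the Pauli matrices. -/
theorem exists_pauli_form (Z₁ Z₂ Z₃ : Matrix (Fin 2) (Fin 2) ℂ) {m₁ m₂ m₃ : ℝ}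
    (hm₁ : 0 < m₁) (hm₂ : 0 < m₂) (h₁ : Z₁.trace = 0) (h₂ : Z₂.trace = 0) (h₃ : Z₃.trace = 0)
    (h₁₂ : (Z₁ * Z₂).trace = 0) (h₁₃ : (Z₁ * Z₃).trace = 0) (h₂₃ : (Z₂ * Z₃).trace = 0)
    (d₁ : Z₁.det = m₁) (d₂ : Z₂.det = m₂) (d₃ : Z₃.det = m₃) :
    ∃ P : Matrix (Fin 2) (Fin 2) ℂ, P.det ≠ 0 ∧ ∃ r₁ r₂ w : ℂ, r₁ ^ 2 = -m₁ ∧ r₂ ^ 2 = -m₂ ∧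
      w ^ 2 = m₃ ∧ Z₁ * P = P * !![r₁, 0; 0, -r₁] ∧ Z₂ * P = P * !![0, r₂; r₂, 0] ∧
      Z₃ * P = P * !![0, w; -w, 0] := by
  obtain ⟨r₁, hr₁⟩ := IsAlgClosed.exists_pow_nat_eq (-(m₁ : ℂ)) (n := 2) (by norm_num)
  obtain ⟨r₂, hr₂⟩ := IsAlgClosed.exists_pow_nat_eq (-(m₂ : ℂ)) (n := 2) (by norm_num)
  have hr₁0 : r₁ ≠ 0 := by
    rintro rfl
    have : (m₁ : ℂ) = 0 := by linear_combination hr₁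
    exact hm₁.ne' (by exact_mod_cast this)
  have hr₂0 : r₂ ≠ 0 := by
    rintro rfl
    have : (m₂ : ℂ) = 0 := by linear_combination hr₂
    exact hm₂.ne' (by exact_mod_cast this)
  have hZ₁ : Z₁ * Z₁ = (r₁ ^ 2) • (1 : Matrix (Fin 2) (Fin 2) ℂ) := by
    rw [Matrix.mul_self_of_trace_eq_zero h₁, d₁, hr₁]
  have hZ₂ : Z₂ * Z₂ = (r₂ ^ 2) • (1 : Matrix (Fin 2) (Fin 2) ℂ) := by
    rw [Matrix.mul_self_of_trace_eq_zero h₂, d₂, hr₂]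
  obtain ⟨e, he0, he⟩ : ∃ e : Fin 2 → ℂ, e ≠ 0 ∧ Z₁.mulVec e = r₁ • e := by
    have hdet : (Z₁ - r₁ • (1 : Matrix (Fin 2) (Fin 2) ℂ)).det = 0 := by
      rw [Matrix.det_fin_two] at d₁ ⊢
      rw [Matrix.trace_fin_two] at h₁
      simp
      linear_combination d₁ + hr₁ - r₁ * h₁
    obtain ⟨e, he0, he⟩ := Matrix.exists_mulVec_eq_zero_iff.2 hdet
    refine ⟨e, he0, ?_⟩
    rwa [Matrix.sub_mulVec, Matrix.smul_mulVec, Matrix.one_mulVec, sub_eq_zero] at he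
  have hanti := Matrix.anticommute_of_trace_eq_zero h₁ h₂ h₁₂
  -- By anticommutation `Z₂` carries the `r₁`-eigenvector of `Z₁` to an eigenvector for `-r₁`; the
  -- scaling makes `Z₂` exchange `e` and `f` up to `r₂`.
  set f : Fin 2 → ℂ := r₂⁻¹ • Z₂.mulVec e with hf
  have hZ₂e : Z₂.mulVec e = r₂ • f := by rw [hf, smul_smul, mul_inv_cancel₀ hr₂0, one_smul]
  have hZ₂f : Z₂.mulVec f = r₂ • e := by
    rw [hf, Matrix.mulVec_smul, Matrix.mulVec_mulVec, hZ₂, Matrix.smul_mulVec, Matrix.one_mulVec,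
      smul_smul]
    congr 1
    field_simp
  have hZ₁f : Z₁.mulVec f = -(r₁ • f) := by
    rw [hf, Matrix.mulVec_smul, Matrix.mulVec_mulVec, hanti, Matrix.neg_mulVec,
      ← Matrix.mulVec_mulVec, he, Matrix.mulVec_smul, smul_neg, smul_comm]
  have hf0 : f ≠ 0 := by
    intro h
    rw [h, Matrix.mulVec_zero] at hZ₂f
    exact (smul_ne_zero hr₂0 he0) hZ₂f.symm
  let P : Matrix (Fin 2) (Fin 2) ℂ := Matrix.of fun i j => if j = 0 then e i else f i
  have hP0 : ∀ i, P i 0 = e i := fun i => by simp [P]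
  have hP1 : ∀ i, P i 1 = f i := fun i => by simp [P]
  have e1 : Z₁ * P = P * !![r₁, 0; 0, -r₁] := by
    ext i j
    have a := congrFun he i
    have b := congrFun hZ₁f i
    simp only [Matrix.mulVec, dotProduct, Fin.sum_univ_two, Pi.smul_apply, Pi.neg_apply,
      smul_eq_mul] at a b
    fin_cases j <;> simp [Matrix.mul_apply, Fin.sum_univ_two, hP0, hP1]
    · linear_combination a
    · linear_combination b
  have e2 : Z₂ * P = P * !![0, r₂; r₂, 0] := by
    ext i j
    have a := congrFun hZ₂e i
    have b := congrFun hZ₂f i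
    simp only [Matrix.mulVec, dotProduct, Fin.sum_univ_two, Pi.smul_apply,
      smul_eq_mul] at a b
    fin_cases j <;> simp [Matrix.mul_apply, Fin.sum_univ_two, hP0, hP1]
    · linear_combination a
    · linear_combination b
  have hdet : P.det ≠ 0 := by
    intro h
    obtain ⟨x, hx0, hx⟩ := Matrix.exists_mulVec_eq_zero_iff.2 h
    have hx1 : ∀ i, e i * x 0 + f i * x 1 = 0 := by
      intro i
      have := congrFun hx i
      simpa [Matrix.mulVec, dotProduct, Fin.sum_univ_two, hP0, hP1] using this
    have hx2 : ∀ i, r₁ * (e i * x 0 - f i * x 1) = 0 := by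
      intro i
      have a := congrFun he i
      have b := congrFun hZ₁f i
      simp only [Matrix.mulVec, dotProduct, Fin.sum_univ_two, Pi.smul_apply, Pi.neg_apply,
        smul_eq_mul] at a b
      linear_combination -(x 0) * a - x 1 * b + Z₁ i 0 * hx1 0 + Z₁ i 1 * hx1 1
    have hx3 : ∀ i, e i * x 0 = 0 := by
      intro i
      have := (mul_eq_zero.1 (hx2 i)).resolve_left hr₁0
      linear_combination (hx1 i + this) / 2
    have hx4 : ∀ i, f i * x 1 = 0 := fun i => by linear_combination hx1 i - hx3 i
    have x0 : x 0 = 0 := by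
      by_contra hne
      exact he0 (funext fun i => (mul_eq_zero.1 (hx3 i)).resolve_right hne)
    have x1 : x 1 = 0 := by
      by_contra hne
      exact hf0 (funext fun i => (mul_eq_zero.1 (hx4 i)).resolve_right hne)
    exact hx0 (funext fun i => by fin_cases i <;> simpa)
  have hu : IsUnit P.det := isUnit_iff_ne_zero.2 hdet
  -- `W` is `Z₃` in the basis `e, f`. Trace-orthogonality to `1`, `Z₁` and `Z₂` leaves only the
  -- antisymmetric direction, and the determinant fixes its size.
  set W : Matrix (Fin 2) (Fin 2) ℂ := P⁻¹ * Z₃ * P with hW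
  have e3 : Z₃ * P = P * W := by
    rw [hW, Matrix.mul_assoc, Matrix.mul_nonsing_inv_cancel_left _ _ hu]
  have hconj : ∀ M K : Matrix (Fin 2) (Fin 2) ℂ, M * P = P * K → (W * K).trace = (M * Z₃).trace := by
    intro M K hMK
    rw [hW, Matrix.mul_assoc, ← hMK, Matrix.mul_assoc, Matrix.trace_mul_comm, Matrix.mul_assoc,
      Matrix.mul_assoc, Matrix.mul_nonsing_inv _ hu, Matrix.mul_one, Matrix.trace_mul_comm]
  have t1 := (hconj _ _ e1).trans h₁₃
  have t2 := (hconj _ _ e2).trans h₂₃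
  have t3 : W.trace = 0 := by
    have := hconj 1 1 (by simp)
    rwa [Matrix.mul_one, Matrix.one_mul, h₃] at this
  have t4 : W.det = m₃ := by
    have := congrArg Matrix.det e3
    rw [Matrix.det_mul, Matrix.det_mul, d₃] at this
    exact mul_left_cancel₀ hdet (by linear_combination -this)
  simp only [Matrix.trace_fin_two, Matrix.mul_apply, Fin.sum_univ_two] at t1 t2
  simp [Matrix.trace_fin_two] at t1 t2 t3
  have a1 : W 0 0 = 0 := by
    have : r₁ * (W 0 0 - W 1 1) = 0 := by linear_combination t1
    have := (mul_eq_zero.1 this).resolve_left hr₁0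
    linear_combination (this + t3) / 2
  have a2 : W 1 1 = 0 := by linear_combination t3 - a1
  have a3 : W 1 0 = -W 0 1 := by
    have : r₂ * (W 0 1 + W 1 0) = 0 := by linear_combination t2
    have := (mul_eq_zero.1 this).resolve_left hr₂0
    linear_combination this
  refine ⟨P, hdet, r₁, r₂, W 0 1, hr₁, hr₂, ?_, e1, e2, ?_⟩
  · rw [Matrix.det_fin_two, a1, a2, a3] at t4
    linear_combination t4
  · rw [e3]
    congr 1
    ext i j
    fin_cases i <;> fin_cases j <;> simp [a1, a2, a3]

theorem exists_unit_vector_orthogonal (z x : ℝ) :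
    ∃ α β : ℝ, α ^ 2 + β ^ 2 = 1 ∧ α * z + β * x = 0 := by
  by_cases h : x ^ 2 + z ^ 2 = 0
  · have hz : z = 0 := by nlinarith [sq_nonneg x, sq_nonneg z]
    have hx : x = 0 := by nlinarith [sq_nonneg x, sq_nonneg z]
    exact ⟨1, 0, by norm_num, by simp [hz]⟩
  · have hs : Real.sqrt (x ^ 2 + z ^ 2) ^ 2 = x ^ 2 + z ^ 2 := Real.sq_sqrt (by positivity)
    have hne : Real.sqrt (x ^ 2 + z ^ 2) ≠ 0 := fun h0 => h (by rw [← hs, h0]; norm_num)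
    refine ⟨x / Real.sqrt (x ^ 2 + z ^ 2), -z / Real.sqrt (x ^ 2 + z ^ 2), ?_, ?_⟩
    · rw [div_pow, div_pow, ← add_div, neg_sq, hs, div_self h]
    · ring

/-- For a Takagi-diagonal nondegenerate ensemble some direction `N` of the second qubit is sent to
a matrix whose determinant is bounded by two of the signed sums of the Takagi values. -/
theorem exists_direction_of_diagonal (Y : Fin 4 → Matrix (Fin 2) (Fin 2) ℂ) (l : Fin 4 → ℝ)
    (hl : ∀ i, 0 < l i) (hY : detGram Y = Matrix.diagonal fun i => (l i : ℂ)) :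
    ∃ N : Matrix (Fin 2) (Fin 2) ℂ, N.IsHermitian ∧ N.trace = 0 ∧ N.det = -1 ∧
      ∃ α β : ℝ, α ^ 2 + β ^ 2 = 1 ∧ -4 * (ensembleMap Y N).det =
        (((α * (l 0 + l 1 - l 2 - l 3)) ^ 2 + (β * (l 0 - l 1 + l 2 - l 3)) ^ 2 : ℝ) : ℂ) := by
  have hform : ∀ i j, detForm (Y i) (Y j) = if i = j then (l i : ℂ) else 0 := by
    intro i j
    have := congrFun (congrFun hY i) j
    simpa [detGram, Matrix.diagonal_apply] using this
  have hdet : ∀ i, (Y i).det = l i / 2 := by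
    intro i
    have := hform i i
    rw [detForm_self, if_pos rfl] at this
    linear_combination this / 2
  -- As `detForm X Y = tr(adj X * Y)`, multiplication by the adjugate of `Y 0` turns `Y 0` into a
  -- scalar and the other members into traceless, mutually trace-orthogonal matrices.
  set Z : Fin 4 → Matrix (Fin 2) (Fin 2) ℂ := fun k => (Y 0).adjugate * Y k with hZ
  have hYZ : ∀ k, Y 0 * Z k = (l 0 / 2 : ℂ) • Y k := by
    intro k
    rw [hZ]
    simp only
    rw [← Matrix.mul_assoc, Matrix.mul_adjugate, hdet, Matrix.smul_mul, Matrix.one_mul]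
  have hZtr : ∀ k, k ≠ 0 → (Z k).trace = 0 := by
    intro k hk
    have := hform 0 k
    rw [if_neg hk.symm] at this
    rw [← this]
    simp only [hZ, Matrix.adjugate_fin_two, Matrix.trace_fin_two, Matrix.mul_apply,
      Fin.sum_univ_two, detForm]
    simp
    ring
  have hZZ : ∀ j k, j ≠ 0 → k ≠ 0 → j ≠ k → (Z j * Z k).trace = 0 := by
    intro j k hj hk hjk
    have h1 := hform 0 j
    have h2 := hform 0 k
    have h3 := hform j k
    rw [if_neg hj.symm] at h1
    rw [if_neg hk.symm] at h2
    rw [if_neg hjk] at h3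
    simp only [hZ, Matrix.adjugate_fin_two, Matrix.trace_fin_two, Matrix.mul_apply,
      Fin.sum_univ_two]
    simp only [detForm] at h1 h2 h3
    simp
    linear_combination
      (Y 0 0 0 * Y k 1 1 + Y 0 1 1 * Y k 0 0 - Y 0 0 1 * Y k 1 0 - Y 0 1 0 * Y k 0 1) * h1
      - (Y 0 0 0 * Y 0 1 1 - Y 0 0 1 * Y 0 1 0) * h3
  have hZdet : ∀ k, (Z k).det = ((l 0 * l k / 4 : ℝ) : ℂ) := by
    intro k
    rw [hZ]
    simp only
    rw [Matrix.det_mul, Matrix.det_adjugate, hdet, hdet]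
    simp
    ring
  have hpos : ∀ k, 0 < l 0 * l k / 4 := fun k => by have := hl 0; have := hl k; positivity
  obtain ⟨P, hP, r₁, r₂, w, hr₁, hr₂, hw, e₁, e₂, e₃⟩ := exists_pauli_form (Z 1) (Z 2) (Z 3)
    (hpos 1) (hpos 2) (hZtr 1 (by decide)) (hZtr 2 (by decide)) (hZtr 3 (by decide))
    (hZZ 1 2 (by decide) (by decide) (by decide)) (hZZ 1 3 (by decide) (by decide) (by decide))
    (hZZ 2 3 (by decide) (by decide) (by decide)) (hZdet 1) (hZdet 2) (hZdet 3)
  have e₀ : Z 0 * P = P * !![(l 0 / 2 : ℂ), 0; 0, (l 0 / 2 : ℂ)] := by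
    have h0 : Z 0 = (l 0 / 2 : ℂ) • (1 : Matrix (Fin 2) (Fin 2) ℂ) := by
      rw [hZ]
      simp only
      rw [Matrix.adjugate_mul, hdet]
    have h1 : !![(l 0 / 2 : ℂ), 0; 0, (l 0 / 2 : ℂ)]
        = (l 0 / 2 : ℂ) • (1 : Matrix (Fin 2) (Fin 2) ℂ) := by
      ext i j; fin_cases i <;> fin_cases j <;> simp
    rw [h0, h1]
    simp
  -- The two reals are the coefficients of `α` and `β` in the trace of `P * K * Pᴴ`; this choice
  -- makes `N` traceless.
  obtain ⟨α, β, hαβ, horth⟩ := exists_unit_vector_orthogonal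
    (‖P 0 0‖ ^ 2 + ‖P 1 0‖ ^ 2 - ‖P 0 1‖ ^ 2 - ‖P 1 1‖ ^ 2)
    (2 * (P 0 0 * star (P 0 1) + P 1 0 * star (P 1 1)).re)
  -- The scaling that gives `det N = c² |det P|² det K = -1`.
  set c : ℝ := ‖P.det‖⁻¹ with hc
  have hcP : (c : ℂ) ^ 2 * (P.det * star P.det) = 1 := by
    have h1 : P.det * star P.det = ((‖P.det‖ ^ 2 : ℝ) : ℂ) := by
      rw [Complex.star_def, Complex.mul_conj, Complex.normSq_eq_norm_sq]
    have h2 : ‖P.det‖ ≠ 0 := by simpa using hP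
    rw [h1, hc, ← Complex.ofReal_pow, ← Complex.ofReal_mul, inv_pow,
      inv_mul_cancel₀ (pow_ne_zero 2 h2), Complex.ofReal_one]
  set K : Matrix (Fin 2) (Fin 2) ℂ := !![(α : ℂ), β; β, -α] with hK
  have hKh : K.conjTranspose = K := by
    ext i j; fin_cases i <;> fin_cases j <;> simp [hK]
  have hKdet : K.det = -1 := by
    have : ((α ^ 2 + β ^ 2 : ℝ) : ℂ) = 1 := by rw [hαβ]; simp
    push_cast at this
    rw [hK, Matrix.det_fin_two_of]
    linear_combination -this
  set N : Matrix (Fin 2) (Fin 2) ℂ := (c : ℂ) • (P * K * P.conjTranspose) with hN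
  refine ⟨N, ?_, ?_, ?_, α, β, hαβ, ?_⟩
  · rw [Matrix.IsHermitian, hN, Matrix.conjTranspose_smul, Matrix.conjTranspose_mul,
      Matrix.conjTranspose_mul, Matrix.conjTranspose_conjTranspose, hKh, Matrix.mul_assoc]
    simp
  · rw [hN, Matrix.trace_smul]
    have h1 : (P * K * P.conjTranspose).trace
        = ((α * (‖P 0 0‖ ^ 2 + ‖P 1 0‖ ^ 2 - ‖P 0 1‖ ^ 2 - ‖P 1 1‖ ^ 2)
          + β * (2 * (P 0 0 * star (P 0 1) + P 1 0 * star (P 1 1)).re) : ℝ) : ℂ) := by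
      have hre : ∀ u : ℂ, ((u.re : ℝ) : ℂ) = (u + star u) / 2 := fun u => by
        rw [Complex.star_def, Complex.re_eq_add_conj]
      have hsq : ∀ u : ℂ, (‖u‖ : ℂ) ^ 2 = u * star u := fun u => by
        rw [Complex.star_def, Complex.mul_conj, Complex.normSq_eq_norm_sq]; norm_cast
      push_cast
      rw [hre]
      simp only [hsq, Matrix.trace_fin_two, Matrix.mul_apply, Fin.sum_univ_two,
        Matrix.conjTranspose_apply, star_add, star_mul', star_star]
      simp [hK]
      ring
    rw [h1, horth]
    simp
  · rw [hN, Matrix.det_smul, Matrix.det_mul, Matrix.det_mul, Matrix.det_conjTranspose, hKdet]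
    simp only [Fintype.card_fin]
    linear_combination -hcP
  · set K' : Matrix (Fin 2) (Fin 2) ℂ := !![(α * (l 0 + l 1 - l 2 - l 3) : ℂ),
      β * (l 0 - l 1 + l 2 - l 3); β * (l 0 - l 1 + l 2 - l 3),
      -(α * (l 0 + l 1 - l 2 - l 3))] with hK'
    have hterm : ∀ k (W : Matrix (Fin 2) (Fin 2) ℂ), Z k * P = P * W →
        Z k * N * (Z k).conjTranspose
          = (c : ℂ) • (P * (W * K * W.conjTranspose) * P.conjTranspose) := by
      intro k W hW
      have hW' : P.conjTranspose * (Z k).conjTranspose = W.conjTranspose * P.conjTranspose := by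
        rw [← Matrix.conjTranspose_mul, hW, Matrix.conjTranspose_mul]
      rw [hN, Matrix.mul_smul, Matrix.smul_mul]
      congr 1
      calc _ = (Z k * P) * K * (P.conjTranspose * (Z k).conjTranspose) := by
            simp only [Matrix.mul_assoc]
        _ = _ := by rw [hW, hW']; simp only [Matrix.mul_assoc]
    have hnorm : ∀ (r : ℂ) (m : ℝ), 0 < m → r ^ 2 = -m ∨ r ^ 2 = m → r * star r = m := by
      intro r m hm h
      have h1 : r * star r = ((‖r‖ ^ 2 : ℝ) : ℂ) := by
        rw [Complex.star_def, Complex.mul_conj, Complex.normSq_eq_norm_sq]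
      have h2 : ‖r ^ 2‖ = m := by
        rcases h with h | h <;> rw [h]
        · rw [norm_neg, Complex.norm_real, Real.norm_of_nonneg hm.le]
        · rw [Complex.norm_real, Real.norm_of_nonneg hm.le]
      rw [h1, ← norm_pow, h2]
    have n₁ := hnorm r₁ _ (hpos 1) (Or.inl hr₁)
    have n₂ := hnorm r₂ _ (hpos 2) (Or.inl hr₂)
    have n₃ := hnorm w _ (hpos 3) (Or.inr hw)
    push_cast at n₁ n₂ n₃
    -- Conjugation by the identity and the three Pauli-type matrices multiplies the diagonal part of
    -- `K` by the signs `+ + - -` and the off-diagonal part by `+ - + -`; this is the origin of the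
    -- two signed sums.
    have hWK : !![(l 0 / 2 : ℂ), 0; 0, (l 0 / 2 : ℂ)] * K
          * (!![(l 0 / 2 : ℂ), 0; 0, (l 0 / 2 : ℂ)]).conjTranspose
        + !![r₁, 0; 0, -r₁] * K * (!![r₁, 0; 0, -r₁]).conjTranspose
        + !![0, r₂; r₂, 0] * K * (!![0, r₂; r₂, 0]).conjTranspose
        + !![0, w; -w, 0] * K * (!![0, w; -w, 0]).conjTranspose = (l 0 / 4 : ℂ) • K' := by
      simp only [Complex.star_def] at n₁ n₂ n₃
      ext i j
      fin_cases i <;> fin_cases j <;>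
        simp only [hK, hK', Matrix.mul_apply, Fin.sum_univ_two, Matrix.add_apply,
          Matrix.conjTranspose_apply, Matrix.smul_apply] <;> simp
      · linear_combination (α : ℂ) * (n₁ - n₂ - n₃)
      · linear_combination (β : ℂ) * (-n₁ + n₂ - n₃)
      · linear_combination (β : ℂ) * (-n₁ + n₂ - n₃)
      · linear_combination -(α : ℂ) * (n₁ - n₂ - n₃)
    have hsum : ((l 0 / 2 : ℂ) * (l 0 / 2)) • ensembleMap Y N
        = ((c : ℂ) * (l 0 / 4)) • (Y 0 * (P * K' * P.conjTranspose) * (Y 0).conjTranspose) := by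
      have hstar : star (l 0 / 2 : ℂ) = l 0 / 2 := by simp
      have h1 : ∀ k, ((l 0 / 2 : ℂ) * (l 0 / 2)) • (Y k * N * (Y k).conjTranspose)
          = Y 0 * (Z k * N * (Z k).conjTranspose) * (Y 0).conjTranspose := by
        intro k
        have h2 : (Z k).conjTranspose * (Y 0).conjTranspose
            = (l 0 / 2 : ℂ) • (Y k).conjTranspose := by
          rw [← Matrix.conjTranspose_mul, hYZ, Matrix.conjTranspose_smul, hstar]
        calc _ = ((l 0 / 2 : ℂ) • Y k) * N * ((l 0 / 2 : ℂ) • (Y k).conjTranspose) := by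
              simp only [Matrix.smul_mul, Matrix.mul_smul, smul_smul]
          _ = (Y 0 * Z k) * N * ((Z k).conjTranspose * (Y 0).conjTranspose) := by rw [hYZ, h2]
          _ = _ := by simp only [Matrix.mul_assoc]
      rw [ensembleMap, Finset.smul_sum]
      simp only [h1]
      rw [← Finset.sum_mul, ← Finset.mul_sum, Fin.sum_univ_four, hterm 0 _ e₀, hterm 1 _ e₁,
        hterm 2 _ e₂, hterm 3 _ e₃, ← smul_add, ← smul_add, ← smul_add, ← Matrix.add_mul,
        ← Matrix.add_mul, ← Matrix.add_mul, ← Matrix.mul_add, ← Matrix.mul_add, ← Matrix.mul_add,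
        hWK]
      simp only [Matrix.smul_mul, Matrix.mul_smul, smul_smul]
    have hd := congrArg Matrix.det hsum
    rw [Matrix.det_smul, Matrix.det_smul, Matrix.det_mul, Matrix.det_mul, Matrix.det_mul,
      Matrix.det_mul, Matrix.det_conjTranspose, Matrix.det_conjTranspose, hdet] at hd
    have hK'det : K'.det = -((α * (l 0 + l 1 - l 2 - l 3)) ^ 2
        + (β * (l 0 - l 1 + l 2 - l 3)) ^ 2 : ℂ) := by
      rw [hK', Matrix.det_fin_two_of]; ring
    rw [hK'det] at hd
    simp only [Fintype.card_fin] at hd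
    have hstar : star (l 0 / 2 : ℂ) = l 0 / 2 := by simp
    rw [hstar] at hd
    have hl0 : (l 0 : ℂ) ≠ 0 := by exact_mod_cast (hl 0).ne'
    have hl4 : (l 0 : ℂ) ^ 4 ≠ 0 := pow_ne_zero 4 hl0
    push_cast
    apply mul_left_cancel₀ hl4
    linear_combination -64 * hd + (l 0 : ℂ) ^ 4 * ((α * (l 0 + l 1 - l 2 - l 3)) ^ 2
        + (β * (l 0 - l 1 + l 2 - l 3)) ^ 2 : ℂ) * hcP

/-! ### Optimal measurement direction, by closure from the nondegenerate case -/

/-- The map depends on the ensemble only through the state `ρ`. -/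
theorem ensembleMap_mixEnsemble {n : ℕ} (X : Fin n → Matrix (Fin 2) (Fin 2) ℂ)
    {U : Matrix (Fin n) (Fin n) ℂ} (hU : U ∈ Matrix.unitaryGroup (Fin n) ℂ)
    (N : Matrix (Fin 2) (Fin 2) ℂ) : ensembleMap (mixEnsemble X U) N = ensembleMap X N := by
  have key : ∀ Y : Fin n → Matrix (Fin 2) (Fin 2) ℂ, ∀ a a', ensembleMap Y N a a'
      = ∑ b, ∑ b', N b b' * ∑ k, Y k a b * star (Y k a' b') := by
    intro Y a a'
    simp only [ensembleMap, Matrix.sum_apply, Matrix.mul_apply, Matrix.conjTranspose_apply,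
      Fin.sum_univ_two, Finset.mul_sum, ← Finset.sum_add_distrib]
    exact Finset.sum_congr rfl fun _ _ => by ring
  ext a a'
  rw [key, key]
  simp only [sum_mixEnsemble_mul_star X hU]

/-- A Takagi-diagonal ensemble of four vectors can be mixed into four vectors of equal
determinant, for any choice of phases of the Takagi values. -/
theorem exists_mix_det_eq (Y : Fin 4 → Matrix (Fin 2) (Fin 2) ℂ) (l : Fin 4 → ℝ)
    (hY : detGram Y = Matrix.diagonal fun i => (l i : ℂ)) (θ : Fin 4 → ℂ)
    (hθ : ∀ i, θ i * star (θ i) = 1) :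
    ∃ U ∈ Matrix.unitaryGroup (Fin 4) ℂ, ∀ m,
      2 * (mixEnsemble Y U m).det = (∑ k, θ k ^ 2 * l k) / 4 := by
  -- All entries of this Hadamard matrix have square `1/4`, so each mixed vector weights the values
  -- `θ k ^ 2 * l k` equally.
  let H : Matrix (Fin 4) (Fin 4) ℂ :=
    !![1/2, 1/2, 1/2, 1/2; 1/2, -1/2, 1/2, -1/2; 1/2, 1/2, -1/2, -1/2; 1/2, -1/2, -1/2, 1/2]
  have hH : H ∈ Matrix.unitaryGroup (Fin 4) ℂ := by
    rw [Matrix.mem_unitaryGroup_iff]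
    ext i j
    simp only [Matrix.mul_apply, Matrix.star_apply, Fin.sum_univ_four]
    fin_cases i <;> fin_cases j <;> simp [H] <;> norm_num
  have hD : Matrix.diagonal θ ∈ Matrix.unitaryGroup (Fin 4) ℂ := by
    rw [Matrix.mem_unitaryGroup_iff, Matrix.star_eq_conjTranspose, Matrix.diagonal_conjTranspose,
      Matrix.diagonal_mul_diagonal, ← Matrix.diagonal_one]
    congr 1
    funext i
    exact hθ i
  refine ⟨Matrix.diagonal θ * H, mul_mem hD hH, fun m => ?_⟩
  rw [← detForm_self]
  have h := congrFun (congrFun (detGram_mixEnsemble Y (Matrix.diagonal θ * H)) m) m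
  rw [hY] at h
  rw [show detForm _ _ = detGram (mixEnsemble Y (Matrix.diagonal θ * H)) m m from rfl, h]
  simp only [Matrix.mul_apply, Matrix.transpose_apply, Matrix.diagonal_apply, Fin.sum_univ_four]
  fin_cases m <;> simp [H] <;> ring

/-- The direction yields a convex combination of the squares of two signed sums, while mixing
attains either sum as average concurrence; the one with the smaller square suffices. Optimality of
the decomposition is not needed. -/
theorem exists_mix_and_direction_of_det_ne_zero (X : Fin 4 → Matrix (Fin 2) (Fin 2) ℂ)
    (hX : (detGram X).det ≠ 0) :
    ∃ U ∈ Matrix.unitaryGroup (Fin 4) ℂ, ∃ N : Matrix (Fin 2) (Fin 2) ℂ,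
      N.conjTranspose = N ∧ N.trace = 0 ∧ N.det = -1 ∧
      (∑ m, 2 * ‖(mixEnsemble X U m).det‖) ^ 2 ≤ (-4 * (ensembleMap X N).det).re := by
  obtain ⟨U, hU, l, hl, hY⟩ := exists_mix_detForm_diagonal X
  have hpos : ∀ i, 0 < l i := by
    have hdet : (detGram (mixEnsemble X U)).det ≠ 0 := by
      have hUd : U.det ≠ 0 := by
        intro h
        have := congrArg Matrix.det (Matrix.mem_unitaryGroup_iff.1 hU)
        rw [Matrix.det_mul, h] at this
        simp at this
      rw [detGram_mixEnsemble, Matrix.det_mul, Matrix.det_mul, Matrix.det_transpose]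
      exact mul_ne_zero (mul_ne_zero hUd hX) hUd
    rw [hY, Matrix.det_diagonal, Finset.prod_ne_zero_iff] at hdet
    intro i
    have : l i ≠ 0 := by exact_mod_cast hdet i (Finset.mem_univ i)
    exact lt_of_le_of_ne (hl i) this.symm
  obtain ⟨N, hN, hNt, hNd, α, β, hαβ, hM⟩ := exists_direction_of_diagonal _ l hpos hY
  rw [ensembleMap_mixEnsemble X hU] at hM
  have fin : ∀ θ : Fin 4 → ℂ, (∀ i, θ i * star (θ i) = 1) → ∀ s : ℝ, ∑ k, θ k ^ 2 * l k = s →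
      s ^ 2 ≤ (l 0 + l 1 - l 2 - l 3) ^ 2 → s ^ 2 ≤ (l 0 - l 1 + l 2 - l 3) ^ 2 →
      ∃ U ∈ Matrix.unitaryGroup (Fin 4) ℂ, ∃ N : Matrix (Fin 2) (Fin 2) ℂ,
      N.conjTranspose = N ∧ N.trace = 0 ∧ N.det = -1 ∧
      (∑ m, 2 * ‖(mixEnsemble X U m).det‖) ^ 2 ≤ (-4 * (ensembleMap X N).det).re := by
    intro θ hθ s hs h1 h2
    obtain ⟨V, hV, hdet⟩ := exists_mix_det_eq _ l hY θ hθ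
    refine ⟨U * V, mul_mem hU hV, N, hN, hNt, hNd, ?_⟩
    rw [hM, Complex.ofReal_re, ← mixEnsemble_mul]
    have hm : ∀ m, 2 * ‖(mixEnsemble (mixEnsemble X U) V m).det‖ = |s| / 4 := by
      intro m
      have := congrArg norm (hdet m)
      rw [hs] at this
      simpa using this
    simp only [hm]
    simp only [Finset.sum_const, Finset.card_univ, Fintype.card_fin, nsmul_eq_mul, Nat.cast_ofNat]
    rw [mul_div_cancel₀ _ (by norm_num), sq_abs]
    nlinarith [mul_le_mul_of_nonneg_left h1 (sq_nonneg α),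
      mul_le_mul_of_nonneg_left h2 (sq_nonneg β)]
  -- The phases `1` and `I` enter squared and supply the signs `+` and `-`.
  rcases le_total ((l 0 + l 1 - l 2 - l 3) ^ 2) ((l 0 - l 1 + l 2 - l 3) ^ 2) with h | h
  · refine fin ![1, 1, Complex.I, Complex.I] ?_ _ ?_ le_rfl h
    · intro i; fin_cases i <;> simp
    · simp [Fin.sum_univ_four]; ring
  · refine fin ![1, Complex.I, 1, Complex.I] ?_ _ ?_ h le_rfl
    · intro i; fin_cases i <;> simp
    · simp [Fin.sum_univ_four]; ring

/-- The amplitude matrices whose entries are the rows of `A`. -/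
def rowEnsemble (A : Matrix (Fin 4) (Fin 4) ℂ) (k : Fin 4) : Matrix (Fin 2) (Fin 2) ℂ :=
  !![A k 0, A k 1; A k 2, A k 3]

/-- The determinant form is nondegenerate on `2 × 2` matrices, with Gram matrix `J` in the standard
basis, so linearly independent families are nondegenerate. -/
theorem det_detGram_rowEnsemble_ne_zero {A : Matrix (Fin 4) (Fin 4) ℂ} (hA : A.det ≠ 0) :
    (detGram (rowEnsemble A)).det ≠ 0 := by
  let J : Matrix (Fin 4) (Fin 4) ℂ := !![0, 0, 0, 1; 0, 0, -1, 0; 0, -1, 0, 0; 1, 0, 0, 0]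
  have h : detGram (rowEnsemble A) = A * J * A.transpose := by
    ext i j
    simp [detGram, rowEnsemble, detForm, Matrix.mul_apply, Fin.sum_univ_four, J]
    ring
  have hJ : J * J = 1 := by
    ext i j
    fin_cases i <;> fin_cases j <;> simp [J, Matrix.mul_apply, Fin.sum_univ_four]
  have hJd : J.det ≠ 0 := by
    intro h0
    have := congrArg Matrix.det hJ
    rw [Matrix.det_mul, h0] at this
    simp at this
  rw [h, Matrix.det_mul, Matrix.det_mul, Matrix.det_transpose]
  exact mul_ne_zero (mul_ne_zero hA hJd) hA

/-- Adding a scalar `ε` to `A` makes it singular only at the finitely many roots of a characteristic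
polynomial. -/
theorem Matrix.dense_det_ne_zero {n : ℕ} : Dense {A : Matrix (Fin n) (Fin n) ℂ | A.det ≠ 0} := by
  intro A
  have hfin : {ε : ℂ | (-A).charpoly.eval ε = 0}.Finite := by
    have := (-A).charpoly.roots.toFinset.finite_toSet
    refine this.subset fun ε hε => ?_
    simpa [(Matrix.charpoly_monic (-A)).ne_zero] using hε
  have hev : ∀ᶠ ε in nhdsWithin (0 : ℂ) {0}ᶜ, (A + Matrix.scalar (Fin n) ε).det ≠ 0 := by
    have h1 : ∀ᶠ ε in Filter.cofinite, ε ∉ {ε : ℂ | (-A).charpoly.eval ε = 0} :=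
      hfin.eventually_cofinite_notMem
    filter_upwards [nhdsNE_le_cofinite (0 : ℂ) h1] with ε hε
    have h2 : (-A).charpoly.eval ε ≠ 0 := hε
    rwa [Matrix.eval_charpoly, sub_neg_eq_add, add_comm] at h2
  have hlim : Filter.Tendsto (fun ε : ℂ => A + Matrix.scalar (Fin n) ε)
      (nhdsWithin (0 : ℂ) {0}ᶜ) (nhds A) := by
    have hc : Continuous fun ε : ℂ => A + Matrix.scalar (Fin n) ε := by
      refine continuous_const.add ?_
      exact Continuous.matrix_diagonal (continuous_pi fun _ => continuous_id)
    have := hc.tendsto 0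
    rw [map_zero, add_zero] at this
    exact this.mono_left nhdsWithin_le_nhds
  exact mem_closure_of_tendsto hlim hev

theorem isCompact_unitaryGroup (n : ℕ) :
    IsCompact (Matrix.unitaryGroup (Fin n) ℂ : Set (Matrix (Fin n) (Fin n) ℂ)) := by
  have hbox : IsCompact (Set.univ.pi fun _ => Set.univ.pi fun _ => Metric.closedBall 0 1 :
      Set (Fin n → Fin n → ℂ)) :=
    isCompact_univ_pi fun _ => isCompact_univ_pi fun _ => isCompact_closedBall 0 1
  refine hbox.of_isClosed_subset ?_ ?_
  · have : (Matrix.unitaryGroup (Fin n) ℂ : Set (Matrix (Fin n) (Fin n) ℂ))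
        = {U | U * star U = 1} := by
      ext U; exact Matrix.mem_unitaryGroup_iff
    rw [this]
    exact isClosed_eq (continuous_id.matrix_mul continuous_id.matrix_conjTranspose) continuous_const
  · intro U hU i _ j _
    simpa using entry_norm_bound_of_unitary hU i j

theorem norm_direction_apply_le {N : Matrix (Fin 2) (Fin 2) ℂ} (hN : N.conjTranspose = N)
    (ht : N.trace = 0) (hd : N.det = -1) (i j : Fin 2) : ‖N i j‖ ≤ 1 := by
  have e1 : N 1 1 = -N 0 0 := by
    rw [Matrix.trace_fin_two] at ht; linear_combination ht
  have e2 : N 1 0 = star (N 0 1) := (congrFun (congrFun hN 1) 0).symm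
  have e3 : star (N 0 0) = N 0 0 := congrFun (congrFun hN 0) 0
  have e4 : ‖N 0 0‖ ^ 2 + ‖N 0 1‖ ^ 2 = 1 := by
    have hsq : ∀ u : ℂ, (‖u‖ : ℂ) ^ 2 = u * star u := fun u => by
      rw [Complex.star_def, Complex.mul_conj, Complex.normSq_eq_norm_sq]; norm_cast
    rw [Matrix.det_fin_two, e1, e2] at hd
    have : ((‖N 0 0‖ ^ 2 + ‖N 0 1‖ ^ 2 : ℝ) : ℂ) = 1 := by
      push_cast
      rw [hsq, hsq, e3]
      linear_combination -hd
    exact_mod_cast this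
  have b1 : ‖N 0 0‖ ≤ 1 := by nlinarith [sq_nonneg ‖N 0 1‖, norm_nonneg (N 0 0)]
  have b2 : ‖N 0 1‖ ≤ 1 := by nlinarith [sq_nonneg ‖N 0 0‖, norm_nonneg (N 0 1)]
  fin_cases i <;> fin_cases j
  · exact b1
  · exact b2
  · exact (congrArg norm e2).trans_le (by rwa [norm_star])
  · exact (congrArg norm e1).trans_le (by rwa [norm_neg])

theorem isCompact_directions : IsCompact {N : Matrix (Fin 2) (Fin 2) ℂ |
    N.conjTranspose = N ∧ N.trace = 0 ∧ N.det = -1} := by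
  have hbox : IsCompact (Set.univ.pi fun _ => Set.univ.pi fun _ => Metric.closedBall 0 1 :
      Set (Fin 2 → Fin 2 → ℂ)) :=
    isCompact_univ_pi fun _ => isCompact_univ_pi fun _ => isCompact_closedBall 0 1
  refine hbox.of_isClosed_subset ?_ ?_
  · exact (isClosed_eq continuous_id.matrix_conjTranspose continuous_id).inter
      ((isClosed_eq continuous_id.matrix_trace continuous_const).inter
        (isClosed_eq continuous_id.matrix_det continuous_const))
  · rintro N ⟨hN, ht, hd⟩ i _ j _
    simpa using norm_direction_apply_le hN ht hd i j

/-- Every ensemble of four vectors can be mixed such that its average concurrence is bounded by the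
determinant of the image of some direction of the second qubit. -/
theorem exists_mix_and_direction (X : Fin 4 → Matrix (Fin 2) (Fin 2) ℂ) :
    ∃ U ∈ Matrix.unitaryGroup (Fin 4) ℂ, ∃ N : Matrix (Fin 2) (Fin 2) ℂ,
      N.conjTranspose = N ∧ N.trace = 0 ∧ N.det = -1 ∧
      (∑ m, 2 * ‖(mixEnsemble X U m).det‖) ^ 2 ≤ (-4 * (ensembleMap X N).det).re := by
  let K : Set (Matrix (Fin 4) (Fin 4) ℂ × Matrix (Fin 2) (Fin 2) ℂ) :=
    (Matrix.unitaryGroup (Fin 4) ℂ : Set (Matrix (Fin 4) (Fin 4) ℂ)) ×ˢ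
      {N | N.conjTranspose = N ∧ N.trace = 0 ∧ N.det = -1}
  have hK : IsCompact K := (isCompact_unitaryGroup 4).prod isCompact_directions
  have hKc : CompactSpace K := isCompact_iff_compactSpace.1 hK
  let D : Set (K × Matrix (Fin 4) (Fin 4) ℂ) :=
    {p | (∑ m, 2 * ‖(mixEnsemble (rowEnsemble p.2) p.1.1.1 m).det‖) ^ 2
      ≤ (-4 * (ensembleMap (rowEnsemble p.2) p.1.1.2).det).re}
  have hrow : ∀ k, Continuous fun p : K × Matrix (Fin 4) (Fin 4) ℂ => rowEnsemble p.2 k := by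
    intro k
    refine continuous_matrix fun i j => ?_
    have : ∀ j', Continuous fun p : K × Matrix (Fin 4) (Fin 4) ℂ => p.2 k j' :=
      fun j' => continuous_snd.matrix_elem k j'
    fin_cases i <;> fin_cases j
    · exact this 0
    · exact this 1
    · exact this 2
    · exact this 3
  have hD : IsClosed D := by
    refine isClosed_le ?_ ?_
    · refine (continuous_finsetSum _ fun m _ => continuous_const.mul ?_).pow 2
      refine (Continuous.matrix_det ?_).norm
      refine continuous_finsetSum _ fun k _ => ?_
      have hU : Continuous fun p : K × Matrix (Fin 4) (Fin 4) ℂ => p.1.1.1 k m :=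
        (continuous_fst.comp (continuous_subtype_val.comp continuous_fst)).matrix_elem k m
      exact hU.smul (hrow k)
    · refine Complex.continuous_re.comp (continuous_const.mul (Continuous.matrix_det ?_))
      refine continuous_finsetSum _ fun k _ => ?_
      exact ((hrow k).matrix_mul (continuous_snd.comp
        (continuous_subtype_val.comp continuous_fst))).matrix_mul (hrow k).matrix_conjTranspose
  -- Projection along the compact factor `K` is a closed map, so the families admitting a suitable
  -- pair `(U, N)` form a closed set, and this set contains the dense set of invertible `A`.
  have hcl : IsClosed (Prod.snd '' D) := isClosedMap_snd_of_compactSpace _ hD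
  have hall : ∀ A, A ∈ Prod.snd '' D := by
    intro A
    refine closure_minimal ?_ hcl (Matrix.dense_det_ne_zero A)
    intro B hB
    obtain ⟨U, hU, N, h1, h2, h3, h4⟩ :=
      exists_mix_and_direction_of_det_ne_zero _ (det_detGram_rowEnsemble_ne_zero hB)
    exact ⟨(⟨(U, N), hU, h1, h2, h3⟩, B), h4, rfl⟩
  obtain ⟨⟨⟨⟨U, N⟩, hU, h1, h2, h3⟩, A⟩, h4, hA⟩ :=
    hall (Matrix.of fun k => ![X k 0 0, X k 0 1, X k 1 0, X k 1 1])
  have hX : rowEnsemble A = X := by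
    funext k
    simp only at hA
    rw [hA]
    ext i j
    fin_cases i <;> fin_cases j <;> simp [rowEnsemble]
  refine ⟨U, hU, N, h1, h2, h3, ?_⟩
  rw [← hX]
  exact h4

/-! ### Monogamy of the concurrence for a qubit register -/

/-- Some pure state decomposition of `ρ` (into unnormalized vectors) has average concurrence at
most `c`. -/
def HasDecompositionLE (ρ : Matrix (Fin 2 × Fin 2) (Fin 2 × Fin 2) ℂ) (c : ℝ) : Prop :=
  ∃ (k : ℕ) (X : Fin k → Matrix (Fin 2) (Fin 2) ℂ), IsEnsemble ρ X ∧ ∑ i, 2 * ‖(X i).det‖ ≤ c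

theorem IsEnsemble.hasDecompositionLE {κ : Type*} [Fintype κ]
    {ρ : Matrix (Fin 2 × Fin 2) (Fin 2 × Fin 2) ℂ} {X : κ → Matrix (Fin 2) (Fin 2) ℂ}
    (h : IsEnsemble ρ X) {c : ℝ} (hc : ∑ i, 2 * ‖(X i).det‖ ≤ c) : HasDecompositionLE ρ c := by
  refine ⟨Fintype.card κ, fun i => X ((Fintype.equivFin κ).symm i), fun p q => ?_, ?_⟩
  · rw [h p q]
    exact (Equiv.sum_comp (Fintype.equivFin κ).symm
      fun k => X k p.1 p.2 * star (X k q.1 q.2)).symm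
  · rwa [Equiv.sum_comp (Fintype.equivFin κ).symm fun k => 2 * ‖(X k).det‖]

theorem HasDecompositionLE.add {ρ σ : Matrix (Fin 2 × Fin 2) (Fin 2 × Fin 2) ℂ} {c d : ℝ}
    (hρ : HasDecompositionLE ρ c) (hσ : HasDecompositionLE σ d) :
    HasDecompositionLE (ρ + σ) (c + d) := by
  obtain ⟨k, X, hX, hXc⟩ := hρ
  obtain ⟨m, Y, hY, hYd⟩ := hσ
  refine IsEnsemble.hasDecompositionLE (X := Sum.elim X Y) (fun p q => ?_) ?_
  · simp [Fintype.sum_sum_type, hX p q, hY p q]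
  · simpa [Fintype.sum_sum_type] using add_le_add hXc hYd

theorem HasDecompositionLE.swap {ρ : Matrix (Fin 2 × Fin 2) (Fin 2 × Fin 2) ℂ} {c : ℝ}
    (hρ : HasDecompositionLE ρ c) : HasDecompositionLE (ρ.submatrix Prod.swap Prod.swap) c := by
  obtain ⟨k, X, hX, hXc⟩ := hρ
  refine ⟨k, fun i => (X i).transpose, fun p q => ?_, ?_⟩
  · simp [hX p.swap q.swap]
  · simpa using hXc

/-- The unnormalized state of the first qubit after finding the second one in a pure state. -/
def measuredState (ρ : Matrix (Fin 2 × Fin 2) (Fin 2 × Fin 2) ℂ) (β : Fin 2 → ℂ) :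
    Matrix (Fin 2) (Fin 2) ℂ :=
  Matrix.of fun a a' => ∑ b, ∑ b', β b * star (β b') * ρ (a, b) (a', b')

open scoped ComplexOrder in
theorem Matrix.det_mul_conjTranspose_re_nonneg {m κ : Type*} [Fintype m] [DecidableEq m]
    [Fintype κ] (B : Matrix m κ ℂ) : 0 ≤ (B * B.conjTranspose).det.re :=
  (Complex.nonneg_iff.1 (Matrix.posSemidef_self_mul_conjTranspose B).det_nonneg).1

/-- The measured state is a Gram matrix `B * Bᴴ`, hence positive semidefinite. -/
theorem IsEnsemble.measuredState_det_nonneg {κ : Type*} [Fintype κ]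
    {ρ : Matrix (Fin 2 × Fin 2) (Fin 2 × Fin 2) ℂ} {X : κ → Matrix (Fin 2) (Fin 2) ℂ}
    (h : IsEnsemble ρ X) (β : Fin 2 → ℂ) : 0 ≤ (measuredState ρ β).det.re := by
  have : measuredState ρ β = (Matrix.of fun a k => ∑ b, β b * X k a b)
      * (Matrix.of fun a k => ∑ b, β b * X k a b : Matrix (Fin 2) κ ℂ).conjTranspose := by
    ext a a'
    simp only [measuredState, Matrix.of_apply, h _ _, Matrix.mul_apply,
      Matrix.conjTranspose_apply, Fin.sum_univ_two, star_add, star_mul', Finset.mul_sum,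
      ← Finset.sum_add_distrib]
    exact Finset.sum_congr rfl fun _ _ => by ring
  rw [this]
  exact Matrix.det_mul_conjTranspose_re_nonneg _

/-- A traceless Hermitian matrix of determinant `-1` is the difference of the two projections of
an orthonormal basis. -/
theorem exists_measurement_basis {N : Matrix (Fin 2) (Fin 2) ℂ} (hN : N.conjTranspose = N)
    (ht : N.trace = 0) (hd : N.det = -1) : ∃ β γ : Fin 2 → ℂ,
      (∀ b b', β b * star (β b') + γ b * star (γ b') = if b = b' then 1 else 0) ∧
      ∀ b b', N b b' = β b * star (β b') - γ b * star (γ b') := by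
  have e1 : N 1 1 = -N 0 0 := by
    rw [Matrix.trace_fin_two] at ht; linear_combination ht
  have e2 : N 1 0 = star (N 0 1) := (congrFun (congrFun hN 1) 0).symm
  have e3 : star (N 0 0) = N 0 0 := congrFun (congrFun hN 0) 0
  obtain ⟨z, hz⟩ := Complex.conj_eq_iff_real.1 e3
  rw [Matrix.det_fin_two, e1, e2, hz] at hd
  have hsq : N 0 1 * star (N 0 1) = ((1 - z ^ 2 : ℝ) : ℂ) := by
    push_cast; linear_combination -hd
  have hn : ‖N 0 1‖ ^ 2 = 1 - z ^ 2 := by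
    have h1 : N 0 1 * star (N 0 1) = ((‖N 0 1‖ ^ 2 : ℝ) : ℂ) := by
      rw [Complex.star_def, Complex.mul_conj, Complex.normSq_eq_norm_sq]
    exact_mod_cast h1.symm.trans hsq
  -- The general eigenvectors have denominator `√(2(1 + z))`. At `z = -1` the matrix is `diag(-1,
  -- 1)` and the standard basis serves in reversed order.
  by_cases h : z = -1
  · have hw : N 0 1 = 0 := by
      rw [h] at hn
      have : ‖N 0 1‖ = 0 := by nlinarith [norm_nonneg (N 0 1)]
      simpa using this
    refine ⟨![0, 1], ![1, 0], fun b b' => ?_, fun b b' => ?_⟩ <;> fin_cases b <;> fin_cases b' <;>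
      simp [e1, e2, hw, hz, h]
  · have hz1 : 0 < 1 + z := by
      have : 0 ≤ 1 - z ^ 2 := hn ▸ sq_nonneg _
      have h2 : -1 ≤ z := by nlinarith
      have h3 : -1 < z := lt_of_le_of_ne h2 (Ne.symm h)
      linarith
    set s : ℝ := Real.sqrt (2 * (1 + z)) with hs
    have hs2 : (s : ℂ) ^ 2 = 2 * (1 + z) := by
      have : s ^ 2 = 2 * (1 + z) := Real.sq_sqrt (by positivity)
      exact_mod_cast this
    have hs0 : (s : ℂ) ≠ 0 := by
      have : s ≠ 0 := (Real.sqrt_pos.2 (by positivity)).ne'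
      exact_mod_cast this
    have hz0 : (1 + z : ℂ) ≠ 0 := by exact_mod_cast hz1.ne'
    have hss : star (s : ℂ) = s := Complex.conj_ofReal s
    have hzs : star (1 + z : ℂ) = 1 + z := by simp
    push_cast at hsq
    have q : ∀ u v : ℂ, u / s * (v / s) = u * v / (2 * (1 + z)) := by
      intro u v; rw [div_mul_div_comm, ← sq, hs2]
    have dstar : ∀ u : ℂ, star (u / s) = star u / s := by
      intro u; rw [star_div₀, hss]
    refine ⟨![(1 + z) / s, star (N 0 1) / s], ![-N 0 1 / s, (1 + z) / s],
      fun b b' => ?_, fun b b' => ?_⟩ <;> fin_cases b <;> fin_cases b' <;>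
      simp only [Fin.zero_eta, Fin.mk_one, Matrix.cons_val_zero, Matrix.cons_val_one, dstar,
        star_star, star_neg, hzs, q, e1, e2, hz]
    · simp only [if_true]; field_simp; linear_combination hsq
    · rw [if_neg (by decide)]; field_simp; ring
    · rw [if_neg (by decide)]; field_simp; ring
    · simp only [if_true]; field_simp; linear_combination hsq
    · field_simp; linear_combination hsq
    · field_simp; ring
    · field_simp; ring
    · field_simp; linear_combination -hsq

/-- A measurement of the second qubit and a decomposition of `ρ` witnessing the monogamy
inequality for a purification of the two-qubit state `ρ`. -/
theorem IsEnsemble.exists_measurement {κ : Type*} [Fintype κ]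
    {ρ : Matrix (Fin 2 × Fin 2) (Fin 2 × Fin 2) ℂ} {X : κ → Matrix (Fin 2) (Fin 2) ℂ}
    (h : IsEnsemble ρ X) : ∃ β γ : Fin 2 → ℂ,
      (∀ b b', β b * star (β b') + γ b * star (γ b') = if b = b' then 1 else 0) ∧
      ∃ c : ℝ, 0 ≤ c ∧ HasDecompositionLE ρ c ∧
        c ^ 2 + (Real.sqrt (4 * (measuredState ρ β).det.re)
          + Real.sqrt (4 * (measuredState ρ γ).det.re)) ^ 2
          ≤ 4 * (traceOutRight ρ).det.re := by
  obtain ⟨Y, hY⟩ := h.exists_fin_four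
  obtain ⟨U, hU, N, hN, ht, hd, hle⟩ := exists_mix_and_direction Y
  obtain ⟨β, γ, hI, hNβ⟩ := exists_measurement_basis hN ht hd
  refine ⟨β, γ, hI, _, ?_, (hY.mix hU).hasDecompositionLE le_rfl, ?_⟩
  · exact Finset.sum_nonneg fun _ _ => by positivity
  · have hA : ∀ a a', traceOutRight ρ a a' = measuredState ρ β a a' + measuredState ρ γ a a' := by
      intro a a'
      simp only [measuredState, traceOutRight, Matrix.of_apply, ← Finset.sum_add_distrib,
        ← add_mul, hI]
      simp
    have hM : ∀ a a', ensembleMap Y N a a' = measuredState ρ β a a' - measuredState ρ γ a a' := by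
      intro a a'
      simp only [measuredState, Matrix.of_apply, ← Finset.sum_sub_distrib, ← sub_mul, ← hNβ]
      simp only [ensembleMap, Matrix.sum_apply, Matrix.mul_apply, Matrix.conjTranspose_apply,
        Fin.sum_univ_two, hY _ _, Finset.mul_sum, ← Finset.sum_add_distrib]
      exact Finset.sum_congr rfl fun _ _ => by ring
    -- The parallelogram law for the quadratic form `det` at the sum and difference of the two
    -- measured states. With `(x + y)² ≤ 2(x² + y²)` it reduces the claim to `hle`.
    have hdet : (traceOutRight ρ).det + (ensembleMap Y N).det
        = 2 * ((measuredState ρ β).det + (measuredState ρ γ).det) := by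
      simp only [Matrix.det_fin_two, hA, hM]; ring
    have hdr := congrArg Complex.re hdet
    simp at hdr
    have p1 := h.measuredState_det_nonneg β
    have p2 := h.measuredState_det_nonneg γ
    have s1 := Real.sq_sqrt (show 0 ≤ 4 * (measuredState ρ β).det.re by positivity)
    have s2 := Real.sq_sqrt (show 0 ≤ 4 * (measuredState ρ γ).det.re by positivity)
    simp at hle
    nlinarith [sq_nonneg (Real.sqrt (4 * (measuredState ρ β).det.re)
      - Real.sqrt (4 * (measuredState ρ γ).det.re))]

/-! ### Local measurements on a qubit register and the monogamy induction. -/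

section Register

variable {ι : Type*} [Fintype ι] [DecidableEq ι]

/-- Overwriting bit `i` by both values gives `x` and its flip at `i`, and flipping is an involution.
This double counting explains the factors `1/2` and `1/4` in the reduced states below. -/
theorem sum_update_fin_two {M : Type*} [AddCommMonoid M] (F : (ι → Fin 2) → M) (i : ι) :
    ∑ x, ∑ b, F (Function.update x i b) = 2 • ∑ x, F x := by
  have hinv : Function.Involutive fun x : ι → Fin 2 => Function.update x i (x i + 1) := by
    intro x
    simp only [Function.update_self, Function.update_idem]
    conv_rhs => rw [← Function.update_eq_self i x]
    congr 1
    generalize x i = b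
    revert b
    decide
  have h : ∀ x : ι → Fin 2, ∑ b, F (Function.update x i b)
      = F x + F (Function.update x i (x i + 1)) := by
    intro x
    conv_rhs => rw [← Function.update_eq_self i x]
    simp only [Function.update_idem, Function.update_self]
    rw [Fin.sum_univ_two]
    generalize x i = b
    fin_cases b
    · rfl
    · exact add_comm _ _
  rw [Finset.sum_congr rfl fun x _ => h x, Finset.sum_add_distrib, two_nsmul]
  congr 1
  exact Fintype.sum_bijective _ hinv.bijective _ _ fun _ => rfl

/-- The reduced density matrix of two qubits of a register. -/
noncomputable def pairState (ψ : (ι → Fin 2) → ℂ) (i j : ι) : Matrix (Fin 2 × Fin 2) (Fin 2 × Fin 2) ℂ :=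
  Matrix.of fun p q => (1 / 4) * ∑ x, ψ (Function.update (Function.update x i p.1) j p.2)
    * star (ψ (Function.update (Function.update x i q.1) j q.2))

/-- The reduced density matrix of a qubit of a register. -/
noncomputable def siteState (ψ : (ι → Fin 2) → ℂ) (i : ι) : Matrix (Fin 2) (Fin 2) ℂ :=
  Matrix.of fun a a' => (1 / 2) * ∑ x, ψ (Function.update x i a)
    * star (ψ (Function.update x i a'))

theorem isEnsemble_pairState (ψ : (ι → Fin 2) → ℂ) (i j : ι) :
    IsEnsemble (pairState ψ i j) fun x => Matrix.of fun a b =>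
      (1 / 2) * ψ (Function.update (Function.update x i a) j b) := by
  intro p q
  simp only [pairState, Matrix.of_apply, Finset.mul_sum]
  refine Finset.sum_congr rfl fun x _ => ?_
  simp
  ring

theorem siteState_det_nonneg (ψ : (ι → Fin 2) → ℂ) (i : ι) : 0 ≤ (siteState ψ i).det.re := by
  have : siteState ψ i = (1 / 2 : ℂ) • ((Matrix.of fun a x => ψ (Function.update x i a))
      * (Matrix.of fun a x => ψ (Function.update x i a) :
        Matrix (Fin 2) (ι → Fin 2) ℂ).conjTranspose) := by
    ext a a'
    simp [siteState, Matrix.mul_apply]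
  rw [this, Matrix.det_smul]
  have h := Matrix.det_mul_conjTranspose_re_nonneg
    (Matrix.of fun a x => ψ (Function.update x i a) : Matrix (Fin 2) (ι → Fin 2) ℂ)
  have h2 : ((1 / 2 : ℂ) ^ Fintype.card (Fin 2)) = ((1 / 4 : ℝ) : ℂ) := by
    simp; norm_num
  rw [h2, Complex.re_ofReal_mul]
  positivity

theorem traceOutRight_pairState (ψ : (ι → Fin 2) → ℂ) {i j : ι} (hij : i ≠ j) :
    traceOutRight (pairState ψ i j) = siteState ψ i := by
  ext a a'
  have h := sum_update_fin_two (fun x => ψ (Function.update x i a)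
    * star (ψ (Function.update x i a'))) j
  simp only [Function.update_comm hij.symm] at h
  simp only [traceOutRight, pairState, siteState, Matrix.of_apply]
  rw [← Finset.mul_sum, Finset.sum_comm, h, nsmul_eq_mul]
  push_cast
  ring

/-- The (unnormalized) register state after finding the qubit `B` in a pure state; the qubit `B` is
then left in a state independent of the outcome. -/
noncomputable def measureSite (ψ : (ι → Fin 2) → ℂ) (B : ι) (β : Fin 2 → ℂ) : (ι → Fin 2) → ℂ :=
  fun x => (Real.sqrt (1 / 2) : ℂ) * ∑ b, β b * ψ (Function.update x B b)

theorem measureSite_mul_star {ι : Type*} [DecidableEq ι] (ψ : (ι → Fin 2) → ℂ) (B : ι) (β : Fin 2 → ℂ) (x y : ι → Fin 2) :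
    measureSite ψ B β x * star (measureSite ψ B β y) = (1 / 2) * ∑ b, ∑ b', β b * star (β b')
      * (ψ (Function.update x B b) * star (ψ (Function.update y B b'))) := by
  have h : (Real.sqrt (1 / 2) : ℂ) * (Real.sqrt (1 / 2) : ℂ) = 1 / 2 := by
    rw [← Complex.ofReal_mul, Real.mul_self_sqrt (by norm_num)]
    norm_num
  have hs : star (Real.sqrt (1 / 2) : ℂ) = (Real.sqrt (1 / 2) : ℂ) := Complex.conj_ofReal _
  simp only [measureSite, star_mul', hs, Fin.sum_univ_two, star_add]
  rw [← h]
  ring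

theorem siteState_measureSite (ψ : (ι → Fin 2) → ℂ) (i B : ι) (β : Fin 2 → ℂ) :
    siteState (measureSite ψ B β) i = measuredState (pairState ψ i B) β := by
  ext a a'
  simp only [siteState, measuredState, pairState, Matrix.of_apply, measureSite_mul_star,
    Fin.sum_univ_two, ← Finset.mul_sum, Finset.sum_add_distrib]
  ring

/-- Completeness of the measurement basis: averaging over the outcomes at `B` leaves the state of
the other qubits unchanged. -/
theorem pairState_measureSite_add (ψ : (ι → Fin 2) → ℂ) {i j B : ι} (hi : i ≠ B) (hj : j ≠ B)
    {β γ : Fin 2 → ℂ}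
    (hI : ∀ b b', β b * star (β b') + γ b * star (γ b') = if b = b' then 1 else 0) :
    pairState (measureSite ψ B β) i j + pairState (measureSite ψ B γ) i j = pairState ψ i j := by
  ext p q
  have h := sum_update_fin_two (fun x => ψ (Function.update (Function.update x i p.1) j p.2)
    * star (ψ (Function.update (Function.update x i q.1) j q.2))) B
  simp only [Matrix.add_apply, pairState, Matrix.of_apply, measureSite_mul_star]
  rw [← mul_add, ← Finset.sum_add_distrib]
  simp only [← mul_add, ← Finset.sum_add_distrib, ← add_mul, hI]
  simp only [ite_mul, one_mul, zero_mul, Finset.sum_ite_eq, Finset.mem_univ, if_true]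
  simp only [Function.update_comm hi.symm, Function.update_comm hj.symm] at h
  rw [← Finset.mul_sum, h, nsmul_eq_mul]
  push_cast
  ring

/-- **Monogamy of the concurrence** (Coffman–Kundu–Wootters, Osborne–Verstraete) for a pure state
of a qubit register. -/
theorem exists_monogamous_decompositions (A : ι) (S : Finset ι) : ∀ (_ : A ∉ S)
    (ψ : (ι → Fin 2) → ℂ), ∃ c : ι → ℝ, (∀ j ∈ S, 0 ≤ c j ∧ HasDecompositionLE (pairState ψ A j) (c j)) ∧
      ∑ j ∈ S, c j ^ 2 ≤ 4 * (siteState ψ A).det.re := by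
  induction S using Finset.induction_on with
  | empty =>
    intro _ ψ
    refine ⟨0, by simp, ?_⟩
    have := siteState_det_nonneg ψ A
    simpa using this
  | insert B S hB ih =>
    intro hA ψ
    rw [Finset.mem_insert, not_or] at hA
    obtain ⟨β, γ, hI, c, hc, hdec, hle⟩ := (isEnsemble_pairState ψ A B).exists_measurement
    rw [← siteState_measureSite, ← siteState_measureSite, traceOutRight_pairState ψ hA.1] at hle
    obtain ⟨d, hd, hdle⟩ := ih hA.2 (measureSite ψ B β)
    obtain ⟨e, he, hele⟩ := ih hA.2 (measureSite ψ B γ)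
    have hne : ∀ j ∈ S, j ≠ B := fun j hj h => hB (h ▸ hj)
    -- For `j` in `S` the decompositions belonging to the two outcomes are concatenated, so their
    -- average concurrences add.
    refine ⟨fun j => if j = B then c else d j + e j, ?_, ?_⟩
    · intro j hj
      rcases Finset.mem_insert.1 hj with rfl | hj
      · simpa using ⟨hc, hdec⟩
      · have hjB := hne j hj
        simp only [if_neg hjB]
        refine ⟨add_nonneg (hd j hj).1 (he j hj).1, ?_⟩
        rw [← pairState_measureSite_add ψ hA.1 hjB hI]
        exact (hd j hj).2.add (he j hj).2
    · rw [Finset.sum_insert hB]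
      beta_reduce
      rw [if_pos rfl,
        Finset.sum_congr rfl fun j hj => by rw [if_neg (hne j hj)]]
      have hs1 := Real.sqrt_le_sqrt hdle
      have hs2 := Real.sqrt_le_sqrt hele
      have hcs := Real.sum_mul_le_sqrt_mul_sqrt S d e
      have q1 := Real.sq_sqrt (Finset.sum_nonneg fun j (_ : j ∈ S) => sq_nonneg (d j))
      have q2 := Real.sq_sqrt (Finset.sum_nonneg fun j (_ : j ∈ S) => sq_nonneg (e j))
      have hexp : ∑ j ∈ S, (d j + e j) ^ 2
          = ∑ j ∈ S, d j ^ 2 + ∑ j ∈ S, e j ^ 2 + 2 * ∑ j ∈ S, d j * e j := by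
        rw [Finset.mul_sum, ← Finset.sum_add_distrib, ← Finset.sum_add_distrib]
        exact Finset.sum_congr rfl fun _ _ => by ring
      -- Minkowski's inequality in `ℓ²`; it matches the square of a sum of roots in the measurement
      -- estimate.
      have hM : ∑ j ∈ S, (d j + e j) ^ 2
          ≤ (Real.sqrt (∑ j ∈ S, d j ^ 2) + Real.sqrt (∑ j ∈ S, e j ^ 2)) ^ 2 := by
        rw [hexp]; nlinarith
      have hmono := pow_le_pow_left₀ (add_nonneg (Real.sqrt_nonneg _) (Real.sqrt_nonneg _))
        (add_le_add hs1 hs2) 2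
      linarith

end Register

/-! ### Purities of the marginals of a register, as expectation values of partial swaps -/

/-- The standard Hermitian pairing of functions on a finite type. -/
def pairing {Z : Type*} [Fintype Z] (f g : Z → ℂ) : ℂ := ∑ z, f z * star (g z)

theorem pairing_add_right {Z : Type*} [Fintype Z] (f g h : Z → ℂ) :
    pairing f (g + h) = pairing f g + pairing f h := by
  simp [pairing, mul_add, Finset.sum_add_distrib]

theorem pairing_sub_left {Z : Type*} [Fintype Z] (f g h : Z → ℂ) :
    pairing (f - g) h = pairing f h - pairing g h := by
  simp [pairing, sub_mul, Finset.sum_sub_distrib]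

theorem pairing_sub_right {Z : Type*} [Fintype Z] (f g h : Z → ℂ) :
    pairing f (g - h) = pairing f g - pairing f h := by
  simp [pairing, mul_sub, Finset.sum_sub_distrib]

/-- A symmetric operator with positive multiple of itself as square is positive. -/
theorem pairing_nonneg_of_mul_self {Z : Type*} [Fintype Z] (D : Module.End ℂ (Z → ℂ)) {c : ℝ}
    (hc : 0 < c) (hD : ∀ f g, pairing (D f) g = pairing f (D g)) (hDD : D * D = (c : ℂ) • D)
    (f : Z → ℂ) : 0 ≤ (pairing f (D f)).re := by
  have h1 : (pairing (D f) (D f)).re = c * (pairing f (D f)).re := by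
    rw [hD, ← Module.End.mul_apply, hDD]
    have : pairing f (((c : ℂ) • D) f) = c * pairing f (D f) := by
      simp only [pairing, LinearMap.smul_apply, Pi.smul_apply, smul_eq_mul, Finset.mul_sum]
      refine Finset.sum_congr rfl fun z _ => ?_
      rw [star_mul', show star (c : ℂ) = c from Complex.conj_ofReal c]
      ring
    rw [this, Complex.re_ofReal_mul]
  have h2 : 0 ≤ (pairing (D f) (D f)).re := by
    rw [pairing, Complex.re_sum]
    refine Finset.sum_nonneg fun z _ => ?_
    rw [Complex.star_def, Complex.mul_conj, Complex.ofReal_re]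
    exact Complex.normSq_nonneg _
  rw [h1] at h2
  exact nonneg_of_mul_nonneg_right h2 hc

/-- Exchange of the qubits in `S` between two copies of a register. -/
def copySwap {ι : Type*} [DecidableEq ι] (S : Finset ι) (z : (ι → Fin 2) × (ι → Fin 2)) :
    (ι → Fin 2) × (ι → Fin 2) :=
  (S.piecewise z.2 z.1, S.piecewise z.1 z.2)

theorem copySwap_copySwap {ι : Type*} [DecidableEq ι] {S T : Finset ι} (h : Disjoint S T)
    (z : (ι → Fin 2) × (ι → Fin 2)) : copySwap S (copySwap T z) = copySwap (S ∪ T) z := by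
  ext i <;> simp only [copySwap, Finset.piecewise, Finset.mem_union] <;>
    by_cases hS : i ∈ S <;> by_cases hT : i ∈ T <;> simp [hS, hT]
  all_goals exact absurd hT (Finset.disjoint_left.1 h hS)

theorem copySwap_involutive {ι : Type*} [DecidableEq ι] (S : Finset ι) :
    Function.Involutive (copySwap S) := by
  intro z
  ext i <;> simp only [copySwap, Finset.piecewise] <;> by_cases hS : i ∈ S <;> simp [hS]

section Purity

variable {ι : Type*} [DecidableEq ι]

/-- The operator exchanging the qubits in `S` between two copies of a register. -/
def swapEnd (S : Finset ι) : Module.End ℂ ((ι → Fin 2) × (ι → Fin 2) → ℂ) :=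
  LinearMap.funLeft ℂ ℂ (copySwap S)

theorem swapEnd_mul {S T : Finset ι} (h : Disjoint S T) :
    swapEnd S * swapEnd T = swapEnd (S ∪ T) := by
  refine LinearMap.ext fun f => funext fun z => ?_
  change f (copySwap T (copySwap S z)) = f (copySwap (S ∪ T) z)
  rw [copySwap_copySwap h.symm, Finset.union_comm]

theorem swapEnd_mul_self (S : Finset ι) : swapEnd S * swapEnd S = 1 := by
  refine LinearMap.ext fun f => funext fun z => ?_
  exact congrArg f (copySwap_involutive S z)

theorem swapEnd_empty : swapEnd (∅ : Finset ι) = 1 := by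
  refine LinearMap.ext fun f => funext fun z => ?_
  change f (copySwap ∅ z) = f z
  simp [copySwap]

theorem one_sub_swapEnd_mul_self (S : Finset ι) :
    (1 - swapEnd S) * (1 - swapEnd S) = (2 : ℂ) • (1 - swapEnd S) := by
  have h := swapEnd_mul_self S
  rw [sub_mul, mul_sub, mul_sub, one_mul, mul_one, one_mul, h, two_smul]
  abel

theorem commute_one_sub_swapEnd {S T : Finset ι} (h : Disjoint S T) :
    Commute (1 - swapEnd S) (1 - swapEnd T) := by
  have : Commute (swapEnd S) (swapEnd T) := by
    rw [Commute, SemiconjBy, swapEnd_mul h, swapEnd_mul h.symm, Finset.union_comm]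
  exact ((Commute.one_left _).sub_left ((Commute.one_right _).sub_right this |>.symm).symm)

variable [Fintype ι]

theorem pairing_swapEnd (S : Finset ι) (f g : (ι → Fin 2) × (ι → Fin 2) → ℂ) :
    pairing (swapEnd S f) g = pairing f (swapEnd S g) := by
  refine Fintype.sum_bijective _ (copySwap_involutive S).bijective _ _ fun z => ?_
  change f (copySwap S z) * star (g z)
    = f (copySwap S z) * star (g (copySwap S (copySwap S z)))
  rw [copySwap_involutive S z]

theorem pairing_one_sub_swapEnd (S : Finset ι) (f g : (ι → Fin 2) × (ι → Fin 2) → ℂ) :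
    pairing ((1 - swapEnd S) f) g = pairing f ((1 - swapEnd S) g) := by
  simp only [LinearMap.sub_apply, Module.End.one_apply, pairing_sub_left, pairing_sub_right,
    pairing_swapEnd]

/-- The purity of the reduced state of the qubits in `S`. -/
def marginalPurity (ψ : (ι → Fin 2) → ℂ) (S : Finset ι) : ℝ :=
  (pairing (fun z => ψ z.1 * ψ z.2) (swapEnd S fun z => ψ z.1 * ψ z.2)).re

/-- Exchanging `Sᶜ` amounts to exchanging `S` and then the whole copies, and the doubled state is
symmetric under the latter. -/
theorem marginalPurity_compl (ψ : (ι → Fin 2) → ℂ) (S : Finset ι) :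
    marginalPurity ψ Sᶜ = marginalPurity ψ S := by
  have : (swapEnd Sᶜ fun z => ψ z.1 * ψ z.2) = swapEnd S fun z => ψ z.1 * ψ z.2 := by
    funext z
    change ψ (Sᶜ.piecewise z.2 z.1) * ψ (Sᶜ.piecewise z.1 z.2)
      = ψ (S.piecewise z.2 z.1) * ψ (S.piecewise z.1 z.2)
    rw [Finset.piecewise_compl, Finset.piecewise_compl, mul_comm]
  rw [marginalPurity, this, marginalPurity]

/-- Each `1 - swapEnd` is twice a projection, and disjoint swaps commute; the product is positive
and its expectation in the doubled state expands to the inequality. -/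
theorem marginalPurity_add_le (ψ : (ι → Fin 2) → ℂ) {S T : Finset ι} (h : Disjoint S T) :
    marginalPurity ψ S + marginalPurity ψ T ≤ marginalPurity ψ ∅ + marginalPurity ψ (S ∪ T) := by
  have hc := commute_one_sub_swapEnd h
  have := pairing_nonneg_of_mul_self ((1 - swapEnd S) * (1 - swapEnd T)) (c := 4) (by norm_num)
    (fun f g => by
      rw [hc.eq, Module.End.mul_apply, pairing_one_sub_swapEnd, pairing_one_sub_swapEnd,
        ← Module.End.mul_apply, hc.eq])
    (by
      rw [hc.symm.mul_mul_mul_comm, one_sub_swapEnd_mul_self, one_sub_swapEnd_mul_self,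
        smul_mul_smul_comm]
      norm_num)
    (fun z => ψ z.1 * ψ z.2)
  have he : (1 - swapEnd S) * (1 - swapEnd T)
      = swapEnd ∅ - swapEnd S - swapEnd T + swapEnd (S ∪ T) := by
    rw [← swapEnd_mul h, swapEnd_empty]
    simp only [sub_mul, mul_sub, one_mul, mul_one]
    abel
  rw [he] at this
  simp only [LinearMap.add_apply, LinearMap.sub_apply, pairing_add_right, pairing_sub_right,
    Complex.add_re, Complex.sub_re] at this
  simp only [marginalPurity]
  linarith

/-- Positivity of the product of three commuting operators `1 - swapEnd`; the constant `8` is `2³`.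
It provides the inductive step for subadditivity of mutual information. -/
theorem marginalPurity_submodular (ψ : (ι → Fin 2) → ℂ) {S T W : Finset ι} (hST : Disjoint S T)
    (hSW : Disjoint S W) (hTW : Disjoint T W) :
    marginalPurity ψ S + marginalPurity ψ T + marginalPurity ψ W + marginalPurity ψ (S ∪ T ∪ W)
      ≤ marginalPurity ψ ∅ + marginalPurity ψ (S ∪ T) + marginalPurity ψ (S ∪ W)
        + marginalPurity ψ (T ∪ W) := by
  have h12 := commute_one_sub_swapEnd hST
  have h13 := commute_one_sub_swapEnd hSW
  have h23 := commute_one_sub_swapEnd hTW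
  have h12_3 := h13.mul_left h23
  have := pairing_nonneg_of_mul_self ((1 - swapEnd S) * (1 - swapEnd T) * (1 - swapEnd W))
    (c := 8) (by norm_num)
    (fun f g => by
      rw [h12_3.eq, h12.eq, Module.End.mul_apply, Module.End.mul_apply, pairing_one_sub_swapEnd,
        pairing_one_sub_swapEnd, pairing_one_sub_swapEnd, ← Module.End.mul_apply,
        ← Module.End.mul_apply, ← h12.eq, h12_3.eq])
    (by
      rw [h12_3.symm.mul_mul_mul_comm, h12.symm.mul_mul_mul_comm, one_sub_swapEnd_mul_self,
        one_sub_swapEnd_mul_self, one_sub_swapEnd_mul_self, smul_mul_smul_comm,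
        smul_mul_smul_comm]
      norm_num)
    (fun z => ψ z.1 * ψ z.2)
  have he : (1 - swapEnd S) * (1 - swapEnd T) * (1 - swapEnd W)
      = swapEnd ∅ - swapEnd S - swapEnd T - swapEnd W + swapEnd (S ∪ T) + swapEnd (S ∪ W)
        + swapEnd (T ∪ W) - swapEnd (S ∪ T ∪ W) := by
    rw [← swapEnd_mul (Finset.disjoint_union_left.2 ⟨hSW, hTW⟩), ← swapEnd_mul hST,
      ← swapEnd_mul hSW, ← swapEnd_mul hTW, swapEnd_empty]
    simp only [sub_mul, mul_sub, one_mul, mul_one]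
    abel
  rw [he] at this
  simp only [LinearMap.add_apply, LinearMap.sub_apply, pairing_add_right, pairing_sub_right,
    Complex.add_re, Complex.sub_re] at this
  simp only [marginalPurity]
  linarith

theorem marginalPurity_le_empty (ψ : (ι → Fin 2) → ℂ) (S : Finset ι) :
    marginalPurity ψ S ≤ marginalPurity ψ ∅ := by
  have h := marginalPurity_add_le ψ (disjoint_compl_right (a := S))
  have hu : marginalPurity ψ (S ∪ Sᶜ) = marginalPurity ψ ∅ := by
    rw [← marginalPurity_compl ψ ∅]; simp
  rw [marginalPurity_compl, hu] at h
  linarith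

/-- The mutual information of two sets of qubits with respect to the linear entropy. -/
def linearMutualInfo (ψ : (ι → Fin 2) → ℂ) (S T : Finset ι) : ℝ :=
  marginalPurity ψ ∅ - marginalPurity ψ S - marginalPurity ψ T + marginalPurity ψ (S ∪ T)

theorem linearMutualInfo_le_sum (ψ : (ι → Fin 2) → ℂ) (A : ι) (S : Finset ι) (hA : A ∉ S) :
    linearMutualInfo ψ {A} S ≤ ∑ j ∈ S, linearMutualInfo ψ {A} {j} := by
  induction S using Finset.induction_on with
  | empty => simp [linearMutualInfo]
  | insert B S hB ih =>
    rw [Finset.mem_insert, not_or] at hA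
    rw [Finset.sum_insert hB]
    have h := marginalPurity_submodular ψ (S := {A}) (T := {B}) (W := S)
      (by simpa using hA.1) (by simpa using hA.2) (by simpa using hB)
    have := ih hA.2
    simp only [linearMutualInfo] at this ⊢
    rw [Finset.insert_eq B S, ← Finset.union_assoc]
    linarith

/-- For a pure state, twice the linear entropy of a qubit is bounded by its total pairwise mutual
information. -/
theorem two_mul_linearEntropy_le_sum (ψ : (ι → Fin 2) → ℂ) (A : ι) :
    2 * (marginalPurity ψ ∅ - marginalPurity ψ {A})
      ≤ ∑ j ∈ ({A} : Finset ι)ᶜ, linearMutualInfo ψ {A} {j} := by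
  refine le_trans (le_of_eq ?_) (linearMutualInfo_le_sum ψ A {A}ᶜ (by simp))
  rw [linearMutualInfo, marginalPurity_compl, Finset.union_compl,
    show (Finset.univ : Finset ι) = ∅ᶜ by simp, marginalPurity_compl]
  ring

end Purity

/-! ### Marginal purities in terms of reduced density matrices -/

/-- Overwriting the selected bits by `p` in one copy and `q` in the other counts every pair `n²`
times. The exchange then only interchanges `p` and `q`, so the double sum factors into entries of
the reduced state. -/
theorem sum_mul_sum_update {Ω P : Type*} [Fintype Ω] [Fintype P] (u : P → Ω → Ω) (n : ℕ)
    (hu : ∀ F : Ω → ℂ, ∑ x, ∑ p, F (u p x) = n • ∑ x, F x) (ψ : Ω → ℂ) (F : Ω → Ω → ℂ)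
    (hF : ∀ p q x y, F (u p x) (u q y)
      = ψ (u p x) * ψ (u q y) * star (ψ (u q x) * ψ (u p y))) :
    (n : ℂ) ^ 2 * ∑ x, ∑ y, F x y = ∑ p, ∑ q, (∑ x, ψ (u p x) * star (ψ (u q x)))
      * ∑ y, ψ (u q y) * star (ψ (u p y)) := by
  have h1 : ∑ x, ∑ p, ∑ y, ∑ q, F (u p x) (u q y) = (n : ℂ) ^ 2 * ∑ x, ∑ y, F x y := by
    have h2 : ∀ x, ∑ y, ∑ q, F x (u q y) = n • ∑ y, F x y := fun x => hu (F x)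
    simp only [h2]
    rw [hu fun x => n • ∑ y, F x y, ← Finset.smul_sum, smul_smul, nsmul_eq_mul]
    push_cast
    ring
  rw [← h1, Finset.sum_comm]
  refine Finset.sum_congr rfl fun p _ => ?_
  have h3 : ∀ x, ∑ y, ∑ q, F (u p x) (u q y) = ∑ q, ∑ y, F (u p x) (u q y) :=
    fun x => Finset.sum_comm
  simp only [h3]
  rw [Finset.sum_comm]
  refine Finset.sum_congr rfl fun q _ => ?_
  rw [Finset.sum_mul_sum]
  refine Finset.sum_congr rfl fun x _ => Finset.sum_congr rfl fun y _ => ?_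
  rw [hF, star_mul']
  ring

section Register

variable {ι : Type*} [Fintype ι] [DecidableEq ι]

theorem marginalPurity_eq_sum (ψ : (ι → Fin 2) → ℂ) (S : Finset ι) :
    marginalPurity ψ S = (∑ x, ∑ y, ψ x * ψ y
      * star (ψ (S.piecewise y x) * ψ (S.piecewise x y))).re := by
  rw [marginalPurity, pairing, Fintype.sum_prod_type]
  rfl

theorem marginalPurity_empty {ψ : (ι → Fin 2) → ℂ} (hψ : ∑ x, ψ x * star (ψ x) = 1) :
    marginalPurity ψ ∅ = 1 := by
  have : ∑ x, ∑ y, ψ x * ψ y * star (ψ x * ψ y) = 1 := by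
    rw [← mul_one (1 : ℂ), ← hψ, Finset.sum_mul_sum]
    refine Finset.sum_congr rfl fun x _ => Finset.sum_congr rfl fun y _ => ?_
    rw [star_mul']
    ring
  rw [marginalPurity_eq_sum]
  simp only [Finset.piecewise_empty]
  rw [this, Complex.one_re]

theorem marginalPurity_singleton (ψ : (ι → Fin 2) → ℂ) (i : ι) :
    marginalPurity ψ {i} = (∑ a, ∑ a', siteState ψ i a a' * siteState ψ i a' a).re := by
  have h := sum_mul_sum_update (fun (b : Fin 2) x => Function.update x i b) 2
    (fun F => sum_update_fin_two F i) ψ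
    (fun x y => ψ x * ψ y * star (ψ (({i} : Finset ι).piecewise y x)
      * ψ (({i} : Finset ι).piecewise x y)))
    (fun p q x y => by simp [Finset.piecewise_singleton])
  rw [marginalPurity_eq_sum]
  congr 1
  simp only [siteState, Matrix.of_apply]
  push_cast at h
  have h2 : ∀ a a' : Fin 2, ((1 / 2) * ∑ x, ψ (Function.update x i a) * star (ψ (Function.update x i a')))
      * ((1 / 2) * ∑ x, ψ (Function.update x i a') * star (ψ (Function.update x i a)))
      = (1 / 4) * ((∑ x, ψ (Function.update x i a) * star (ψ (Function.update x i a')))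
      * ∑ x, ψ (Function.update x i a') * star (ψ (Function.update x i a))) := by
    intro a a'; ring
  simp only [h2, ← Finset.mul_sum]
  rw [← h]
  ring

theorem sum_update_update_fin_two (F : (ι → Fin 2) → ℂ) (i j : ι) :
    ∑ x, ∑ p : Fin 2 × Fin 2, F (Function.update (Function.update x i p.1) j p.2)
      = 4 • ∑ x, F x := by
  simp only [Fintype.sum_prod_type]
  rw [sum_update_fin_two (fun x => ∑ b, F (Function.update x j b)) i, sum_update_fin_two F j,
    smul_smul, show 2 * 2 = 4 by norm_num]

theorem marginalPurity_pair (ψ : (ι → Fin 2) → ℂ) {i j : ι} (hij : i ≠ j) :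
    marginalPurity ψ ({i} ∪ {j}) = (∑ p, ∑ q, pairState ψ i j p q * pairState ψ i j q p).re := by
  have h := sum_mul_sum_update (fun (p : Fin 2 × Fin 2) x =>
      Function.update (Function.update x i p.1) j p.2) 4
    (fun F => sum_update_update_fin_two F i j) ψ
    (fun x y => ψ x * ψ y * star (ψ (({i} ∪ {j} : Finset ι).piecewise y x)
      * ψ (({i} ∪ {j} : Finset ι).piecewise x y)))
    (fun p q x y => by
      have hpw : ∀ (p q : Fin 2 × Fin 2) (x y : ι → Fin 2), ({i} ∪ {j} : Finset ι).piecewise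
          (Function.update (Function.update x i p.1) j p.2)
          (Function.update (Function.update y i q.1) j q.2)
          = Function.update (Function.update y i p.1) j p.2 := by
        intro p q x y
        ext k
        by_cases hj : k = j
        · subst hj; simp [Finset.piecewise]
        · by_cases hi : k = i
          · subst hi; simp [Finset.piecewise, hij]
          · simp [Finset.piecewise, hi, hj]
      simp only [hpw])
  rw [marginalPurity_eq_sum]
  congr 1
  simp only [pairState, Matrix.of_apply]
  push_cast at h
  have h2 : ∀ u v : ℂ, (1 / 4 * u) * (1 / 4 * v) = 1 / 16 * (u * v) := by intro u v; ring
  simp only [h2, ← Finset.mul_sum]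
  rw [← h]
  ring

theorem pairState_swap (ψ : (ι → Fin 2) → ℂ) {i j : ι} (hij : i ≠ j) :
    (pairState ψ i j).submatrix Prod.swap Prod.swap = pairState ψ j i := by
  ext p q
  simp [pairState, Function.update_comm hij]

theorem sum_siteState (ψ : (ι → Fin 2) → ℂ) (i : ι) :
    siteState ψ i 0 0 + siteState ψ i 1 1 = ∑ x, ψ x * star (ψ x) := by
  have h := sum_update_fin_two (fun x => ψ x * star (ψ x)) i
  simp only [Fin.sum_univ_two, Finset.sum_add_distrib, nsmul_eq_mul] at h
  simp only [siteState, Matrix.of_apply]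
  push_cast at h
  linear_combination h / 2

theorem trace_pairState (ψ : (ι → Fin 2) → ℂ) (i j : ι) :
    (pairState ψ i j).trace = ∑ x, ψ x * star (ψ x) := by
  have h := sum_update_update_fin_two (fun x => ψ x * star (ψ x)) i j
  rw [Finset.sum_comm, nsmul_eq_mul] at h
  simp only [Matrix.trace, Matrix.diag_apply, pairState, Matrix.of_apply]
  rw [← Finset.mul_sum, h]
  push_cast
  ring

theorem four_mul_det_siteState {ψ : (ι → Fin 2) → ℂ} (hψ : ∑ x, ψ x * star (ψ x) = 1) (i : ι) :
    4 * (siteState ψ i).det.re = 2 * (1 - marginalPurity ψ {i}) := by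
  have h := sum_siteState ψ i
  rw [hψ] at h
  have h1 : 4 * (siteState ψ i).det
      = 2 * (1 - ∑ a, ∑ a', siteState ψ i a a' * siteState ψ i a' a) := by
    simp only [Matrix.det_fin_two, Fin.sum_univ_two]
    linear_combination 2 * (siteState ψ i 0 0 + siteState ψ i 1 1 + 1) * h
  have h2 := congrArg Complex.re h1
  rw [marginalPurity_singleton]
  simpa using h2

/-- The linear mutual information of two qubits is the squared norm of the Gram matrix of the
concurrence form on any decomposition of their joint state. -/
theorem linearMutualInfo_pair {ψ : (ι → Fin 2) → ℂ} (hψ : ∑ x, ψ x * star (ψ x) = 1) {i j : ι}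
    (hij : i ≠ j) {κ : Type*} [Fintype κ] {Y : κ → Matrix (Fin 2) (Fin 2) ℂ}
    (hY : IsEnsemble (pairState ψ i j) Y) :
    linearMutualInfo ψ {i} {j} = ∑ k, ∑ l, ‖detForm (Y k) (Y l)‖ ^ 2 := by
  have hs : siteState ψ i = traceOutRight (pairState ψ i j) := (traceOutRight_pairState ψ hij).symm
  have hs' : siteState ψ j = traceOutRight (pairState ψ j i) :=
    (traceOutRight_pairState ψ hij.symm).symm
  have htr := trace_pairState ψ i j
  rw [hψ] at htr
  have hnorm : ∑ k, ∑ l, ‖detForm (Y k) (Y l)‖ ^ 2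
      = (∑ k, ∑ l, detForm (Y k) (Y l) * star (detForm (Y k) (Y l))).re := by
    rw [Complex.re_sum]
    refine Finset.sum_congr rfl fun k _ => ?_
    rw [Complex.re_sum]
    refine Finset.sum_congr rfl fun l _ => ?_
    rw [Complex.star_def, Complex.mul_conj, Complex.ofReal_re, Complex.normSq_eq_norm_sq]
  have hprod : ∀ p q r s, ∑ k, ∑ l, (Y k p.1 p.2 * star (Y k q.1 q.2))
      * (Y l r.1 r.2 * star (Y l s.1 s.2)) = pairState ψ i j p q * pairState ψ i j r s := by
    intro p q r s
    rw [hY p q, hY r s, Finset.sum_mul_sum]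
  rw [linearMutualInfo, marginalPurity_empty hψ, marginalPurity_singleton, marginalPurity_singleton,
    marginalPurity_pair ψ hij, hs, hs', ← pairState_swap ψ hij, hnorm, ← Complex.one_re,
    ← Complex.sub_re, ← Complex.sub_re, ← Complex.add_re]
  congr 1
  generalize hρ : pairState ψ i j = ρ at *
  -- The index `s` runs over the four terms of `detForm`, with their signs and matrix positions
  -- listed in the vectors; `t` does the same for the conjugate.
  have hexp : ∑ k, ∑ l, detForm (Y k) (Y l) * star (detForm (Y k) (Y l))
      = ∑ k, ∑ l, ∑ s : Fin 4, ∑ t : Fin 4, (![1, 1, -1, -1] s * ![1, 1, -1, -1] t : ℂ) *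
        ((Y k (![0, 1, 0, 1] s) (![0, 1, 1, 0] s) * star (Y k (![0, 1, 0, 1] t) (![0, 1, 1, 0] t)))
        * (Y l (![1, 0, 1, 0] s) (![1, 0, 0, 1] s)
          * star (Y l (![1, 0, 1, 0] t) (![1, 0, 0, 1] t)))) := by
    refine Finset.sum_congr rfl fun k _ => Finset.sum_congr rfl fun l _ => ?_
    simp only [detForm, Fin.sum_univ_four, star_sub, star_add, star_mul']
    simp
    ring
  have hexp2 : ∑ k, ∑ l, detForm (Y k) (Y l) * star (detForm (Y k) (Y l))
      = ∑ s : Fin 4, ∑ t : Fin 4, (![1, 1, -1, -1] s * ![1, 1, -1, -1] t : ℂ) *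
        (ρ (![0, 1, 0, 1] s, ![0, 1, 1, 0] s) (![0, 1, 0, 1] t, ![0, 1, 1, 0] t)
        * ρ (![1, 0, 1, 0] s, ![1, 0, 0, 1] s) (![1, 0, 1, 0] t, ![1, 0, 0, 1] t)) := by
    rw [hexp]
    simp only [← hprod, Finset.mul_sum]
    have hc : ∀ k, ∑ l, ∑ s : Fin 4, ∑ t : Fin 4, (![1, 1, -1, -1] s * ![1, 1, -1, -1] t : ℂ) *
        ((Y k (![0, 1, 0, 1] s) (![0, 1, 1, 0] s) * star (Y k (![0, 1, 0, 1] t) (![0, 1, 1, 0] t)))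
        * (Y l (![1, 0, 1, 0] s) (![1, 0, 0, 1] s)
          * star (Y l (![1, 0, 1, 0] t) (![1, 0, 0, 1] t))))
        = ∑ s : Fin 4, ∑ t : Fin 4, ∑ l, (![1, 1, -1, -1] s * ![1, 1, -1, -1] t : ℂ) *
        ((Y k (![0, 1, 0, 1] s) (![0, 1, 1, 0] s) * star (Y k (![0, 1, 0, 1] t) (![0, 1, 1, 0] t)))
        * (Y l (![1, 0, 1, 0] s) (![1, 0, 0, 1] s)
          * star (Y l (![1, 0, 1, 0] t) (![1, 0, 0, 1] t)))) := by
      intro k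
      rw [Finset.sum_comm]
      exact Finset.sum_congr rfl fun s _ => Finset.sum_comm
    simp only [hc]
    rw [Finset.sum_comm]
    exact Finset.sum_congr rfl fun s _ => Finset.sum_comm
  rw [hexp2]
  simp only [Matrix.trace, Matrix.diag_apply, Fintype.sum_prod_type, Fin.sum_univ_two] at htr
  simp only [traceOutRight, Matrix.of_apply, Matrix.submatrix_apply, Prod.swap,
    Fintype.sum_prod_type, Fin.sum_univ_two, Fin.sum_univ_four]
  simp
  -- The polynomial identity holds with `(Tr ρ)²` in place of `1`.
  linear_combination -(1 + (ρ (0, 0) (0, 0) + ρ (0, 1) (0, 1) + (ρ (1, 0) (1, 0) + ρ (1, 1) (1, 1)))) * htr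

end Register

/-! ### Concurrence and concurrence of assistance of two-qubit states -/

/-- The two-qubit vector with the given amplitude matrix. -/
noncomputable def amplitudeVector (X : Matrix (Fin 2) (Fin 2) ℂ) : EuclideanSpace ℂ (Fin 2 × Fin 2) :=
  WithLp.toLp 2 fun p => X p.1 p.2

theorem EuclideanSpace.sum_mul_star_eq {α : Type*} [Fintype α] (v : EuclideanSpace ℂ α) :
    ∑ p, v p * star (v p) = ((‖v‖ ^ 2 : ℝ) : ℂ) := by
  rw [EuclideanSpace.norm_sq_eq]
  push_cast
  refine Finset.sum_congr rfl fun p _ => ?_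
  rw [Complex.star_def, Complex.mul_conj, Complex.normSq_eq_norm_sq]
  norm_cast

theorem pureConcurrence_of_two_qubits {φ : EuclideanSpace ℂ (Fin 2 × Fin 2)} (hφ : ‖φ‖ = 1) :
    pureConcurrence φ = 2 * ‖φ (0, 0) * φ (1, 1) - φ (0, 1) * φ (1, 0)‖ := by
  have h1 := EuclideanSpace.sum_mul_star_eq φ
  rw [hφ] at h1
  simp only [Fintype.sum_prod_type, Fin.sum_univ_two] at h1
  push_cast at h1
  set d := φ (0, 0) * φ (1, 1) - φ (0, 1) * φ (1, 0) with hd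
  have h2 : Matrix.trace (traceOutRight (pureDensity φ) * traceOutRight (pureDensity φ))
      = 1 - 2 * ((‖d‖ ^ 2 : ℝ) : ℂ) := by
    have h3 : ((‖d‖ ^ 2 : ℝ) : ℂ) = d * star d := by
      rw [Complex.star_def, Complex.mul_conj, Complex.normSq_eq_norm_sq]
    rw [h3, hd]
    simp only [Matrix.trace_fin_two, Matrix.mul_apply, Fin.sum_univ_two, traceOutRight,
      pureDensity, Matrix.of_apply, star_sub, star_mul']
    linear_combination (φ (0, 0) * star (φ (0, 0)) + φ (0, 1) * star (φ (0, 1))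
      + (φ (1, 0) * star (φ (1, 0)) + φ (1, 1) * star (φ (1, 1))) + 1) * h1
  have h4 : 2 * (1 - (1 - 2 * ((‖d‖ ^ 2 : ℝ) : ℂ)).re) = (2 * ‖d‖) ^ 2 := by
    rw [show (2 : ℂ) * ((‖d‖ ^ 2 : ℝ) : ℂ) = ((2 * ‖d‖ ^ 2 : ℝ) : ℂ) by push_cast; ring,
      Complex.sub_re, Complex.one_re, Complex.ofReal_re]
    ring
  rw [pureConcurrence, h2, h4, Real.sqrt_sq (by positivity)]

theorem two_mul_norm_det_le_one {φ : EuclideanSpace ℂ (Fin 2 × Fin 2)} (hφ : ‖φ‖ = 1) :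
    2 * ‖φ (0, 0) * φ (1, 1) - φ (0, 1) * φ (1, 0)‖ ≤ 1 := by
  have h := EuclideanSpace.norm_sq_eq φ
  rw [hφ] at h
  simp only [Fintype.sum_prod_type, Fin.sum_univ_two] at h
  have h1 := norm_sub_le (φ (0, 0) * φ (1, 1)) (φ (0, 1) * φ (1, 0))
  rw [norm_mul, norm_mul] at h1
  nlinarith [sq_nonneg (‖φ (0, 0)‖ - ‖φ (1, 1)‖), sq_nonneg (‖φ (0, 1)‖ - ‖φ (1, 0)‖)]

theorem averageConcurrences_nonneg {α β : Type*} [Fintype α] [Fintype β]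
    {ρ : Matrix (α × β) (α × β) ℂ} {c : ℝ} (hc : c ∈ averageConcurrences ρ) : 0 ≤ c := by
  obtain ⟨k, p, φ, h, rfl⟩ := hc
  exact Finset.sum_nonneg fun i _ => mul_nonneg (h.nonneg i) (Real.sqrt_nonneg _)

/-- Boundedness matters because the real `sSup` of an unbounded set is `0` by convention. -/
theorem averageConcurrences_le_one {ρ : Matrix (Fin 2 × Fin 2) (Fin 2 × Fin 2) ℂ} {c : ℝ}
    (hc : c ∈ averageConcurrences ρ) : c ≤ 1 := by
  obtain ⟨k, p, φ, h, rfl⟩ := hc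
  rw [← h.sum_eq_one]
  refine Finset.sum_le_sum fun i _ => mul_le_of_le_one_right (h.nonneg i) ?_
  rw [pureConcurrence_of_two_qubits (h.norm_eq_one i)]
  exact two_mul_norm_det_le_one (h.norm_eq_one i)

theorem mixedConcurrence_nonneg {α β : Type*} [Fintype α] [Fintype β]
    (ρ : Matrix (α × β) (α × β) ℂ) : 0 ≤ mixedConcurrence ρ :=
  Real.sInf_nonneg fun _ => averageConcurrences_nonneg

/-- The average concurrence of an unnormalized decomposition of a density matrix. -/
theorem IsEnsemble.mem_averageConcurrences {k : ℕ}
    {ρ : Matrix (Fin 2 × Fin 2) (Fin 2 × Fin 2) ℂ} {X : Fin k → Matrix (Fin 2) (Fin 2) ℂ}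
    (h : IsEnsemble ρ X) (hρ : ρ.trace = 1) :
    ∑ i, 2 * ‖(X i).det‖ ∈ averageConcurrences ρ := by
  let v : Fin k → EuclideanSpace ℂ (Fin 2 × Fin 2) := fun i => amplitudeVector (X i)
  have hφ : ∀ i, ∃ φ : EuclideanSpace ℂ (Fin 2 × Fin 2), ‖φ‖ = 1 ∧ v i = (‖v i‖ : ℂ) • φ := by
    intro i
    by_cases h0 : v i = 0
    -- A zero vector carries weight `0`, so any unit vector may represent it.
    · exact ⟨EuclideanSpace.single (0, 0) 1, by simp, by simp [h0]⟩
    · have hn : ‖v i‖ ≠ 0 := by simpa using h0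
      refine ⟨(‖v i‖ : ℂ)⁻¹ • v i, ?_, ?_⟩
      · rw [norm_smul, norm_inv, Complex.norm_real, norm_norm, inv_mul_cancel₀ hn]
      · rw [smul_smul, mul_inv_cancel₀ (by exact_mod_cast hn), one_smul]
  choose φ hφ1 hφv using hφ
  have hX : ∀ i a b, X i a b = ‖v i‖ * φ i (a, b) := by
    intro i a b
    have := congrArg (fun w : EuclideanSpace ℂ (Fin 2 × Fin 2) => w (a, b)) (hφv i)
    simp only [PiLp.smul_apply, smul_eq_mul] at this
    exact this
  have hns : ∀ i, star (‖v i‖ : ℂ) = ‖v i‖ := fun i => Complex.conj_ofReal _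
  refine ⟨k, fun i => ‖v i‖ ^ 2, φ, ⟨fun i => sq_nonneg _, ?_, hφ1, ?_⟩, ?_⟩
  · have h1 : ((∑ i, ‖v i‖ ^ 2 : ℝ) : ℂ) = 1 := by
      rw [← hρ, Matrix.trace]
      simp only [Matrix.diag_apply, h _ _]
      rw [Finset.sum_comm]
      push_cast
      refine Finset.sum_congr rfl fun i _ => ?_
      have := EuclideanSpace.sum_mul_star_eq (v i)
      push_cast at this
      exact this.symm
    exact_mod_cast h1
  · ext p q
    rw [h p q, Matrix.sum_apply]
    refine Finset.sum_congr rfl fun i _ => ?_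
    rw [hX, hX, star_mul', hns]
    simp only [Matrix.smul_apply, pureDensity, Matrix.of_apply, smul_eq_mul, Prod.mk.eta]
    push_cast
    ring
  · refine Finset.sum_congr rfl fun i _ => ?_
    rw [pureConcurrence_of_two_qubits (hφ1 i), Matrix.det_fin_two, hX, hX, hX, hX]
    have : (‖v i‖ : ℂ) * φ i (0, 0) * (‖v i‖ * φ i (1, 1))
        - ‖v i‖ * φ i (0, 1) * (‖v i‖ * φ i (1, 0))
        = ((‖v i‖ ^ 2 : ℝ) : ℂ) * (φ i (0, 0) * φ i (1, 1) - φ i (0, 1) * φ i (1, 0)) := by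
      push_cast; ring
    rw [this, norm_mul, Complex.norm_real, Real.norm_of_nonneg (sq_nonneg _)]
    ring

theorem HasDecompositionLE.mixedConcurrence_le {ρ : Matrix (Fin 2 × Fin 2) (Fin 2 × Fin 2) ℂ}
    {c : ℝ} (h : HasDecompositionLE ρ c) (hρ : ρ.trace = 1) : mixedConcurrence ρ ≤ c := by
  obtain ⟨k, X, hX, hc⟩ := h
  exact (csInf_le ⟨0, fun _ => averageConcurrences_nonneg⟩
    (hX.mem_averageConcurrences hρ)).trans hc

theorem IsEnsemble.le_concurrenceOfAssistance {k : ℕ}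
    {ρ : Matrix (Fin 2 × Fin 2) (Fin 2 × Fin 2) ℂ} {X : Fin k → Matrix (Fin 2) (Fin 2) ℂ}
    (h : IsEnsemble ρ X) (hρ : ρ.trace = 1) :
    ∑ i, 2 * ‖(X i).det‖ ≤ concurrenceOfAssistance ρ :=
  le_csSup ⟨1, fun _ => averageConcurrences_le_one⟩ (h.mem_averageConcurrences hρ)

/-! ### One-qubit entropies against pairwise concurrences. -/

section Register

variable {ι : Type*} [Fintype ι] [DecidableEq ι]

/-- In a Takagi-diagonal decomposition the mutual information is `∑ l²` and the average concurrence
is `∑ l`, with all `l` nonnegative. -/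
theorem linearMutualInfo_le_concurrenceOfAssistance {ψ : (ι → Fin 2) → ℂ}
    (hψ : ∑ x, ψ x * star (ψ x) = 1) {i j : ι} (hij : i ≠ j) :
    linearMutualInfo ψ {i} {j} ≤ concurrenceOfAssistance (pairState ψ i j) ^ 2 := by
  obtain ⟨X, hX⟩ := (isEnsemble_pairState ψ i j).exists_fin_four
  obtain ⟨U, hU, l, hl, hd⟩ := exists_mix_detForm_diagonal X
  have hY := hX.mix hU
  have hform : ∀ m n, detForm (mixEnsemble X U m) (mixEnsemble X U n)
      = if m = n then (l m : ℂ) else 0 := by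
    intro m n
    have := congrFun (congrFun hd m) n
    simpa [detGram, Matrix.diagonal_apply] using this
  have hdet : ∀ m, 2 * ‖(mixEnsemble X U m).det‖ = l m := by
    intro m
    have h1 := hform m m
    rw [detForm_self, if_pos rfl] at h1
    have h2 := congrArg norm h1
    rwa [norm_mul, Complex.norm_ofNat, Complex.norm_real, Real.norm_of_nonneg (hl m)] at h2
  have hle := hY.le_concurrenceOfAssistance (by rw [trace_pairState, hψ])
  simp only [hdet] at hle
  rw [linearMutualInfo_pair hψ hij hY]
  have hsum : ∑ k, ∑ m, ‖detForm (mixEnsemble X U k) (mixEnsemble X U m)‖ ^ 2 = ∑ k, l k ^ 2 := by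
    refine Finset.sum_congr rfl fun k _ => ?_
    rw [Finset.sum_eq_single k]
    · rw [hform, if_pos rfl, Complex.norm_real, Real.norm_eq_abs, sq_abs]
    · intro m _ hm
      rw [hform, if_neg hm.symm]
      simp
    · simp
  rw [hsum]
  calc ∑ k, l k ^ 2 ≤ (∑ k, l k) ^ 2 := by
        exact Finset.sum_sq_le_sq_sum_of_nonneg fun k _ => hl k
    _ ≤ _ := pow_le_pow_left₀ (Finset.sum_nonneg fun k _ => hl k) hle 2

/-- Dual monogamy: the tangle of a qubit with the rest of the register is bounded by the squared
concurrences of assistance. -/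
theorem linearEntropy_le_sum_concurrenceOfAssistance {ψ : (ι → Fin 2) → ℂ}
    (hψ : ∑ x, ψ x * star (ψ x) = 1) (A : ι) :
    2 * (1 - marginalPurity ψ {A})
      ≤ ∑ j ∈ ({A} : Finset ι)ᶜ, concurrenceOfAssistance (pairState ψ A j) ^ 2 := by
  have h := two_mul_linearEntropy_le_sum ψ A
  rw [marginalPurity_empty hψ] at h
  refine h.trans (Finset.sum_le_sum fun j hj => ?_)
  refine linearMutualInfo_le_concurrenceOfAssistance hψ ?_
  rintro rfl
  simp at hj

/-- For two qubits, the total tangle with the rest of the register is bounded by squared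
concurrences of assistance. -/
theorem linearEntropy_add_le_sum_concurrenceOfAssistance {ψ : (ι → Fin 2) → ℂ}
    (hψ : ∑ x, ψ x * star (ψ x) = 1) {A B : ι} (hAB : A ≠ B) :
    2 * (1 - marginalPurity ψ {A}) + 2 * (1 - marginalPurity ψ {B})
      ≤ 2 * concurrenceOfAssistance (pairState ψ A B) ^ 2
        + ∑ i ∈ ({A, B} : Finset ι)ᶜ, (concurrenceOfAssistance (pairState ψ A i) ^ 2
          + concurrenceOfAssistance (pairState ψ B i) ^ 2) := by
  have hA := linearEntropy_le_sum_concurrenceOfAssistance hψ A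
  have hB := two_mul_linearEntropy_le_sum ψ B
  have hcA : ({A} : Finset ι)ᶜ = insert B ({A, B} : Finset ι)ᶜ := by
    ext k; by_cases k = B <;> simp_all [Ne.symm]
  have hcB : ({B} : Finset ι)ᶜ = insert A ({A, B} : Finset ι)ᶜ := by
    ext k; by_cases k = A <;> simp_all
  rw [hcA, Finset.sum_insert (by simp)] at hA
  rw [hcB, Finset.sum_insert (by simp), marginalPurity_empty hψ] at hB
  -- Symmetry of the mutual information puts `A` first, so the assistance of the two orderings need
  -- not be compared.
  have hBA : linearMutualInfo ψ {B} {A} ≤ concurrenceOfAssistance (pairState ψ A B) ^ 2 := by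
    refine le_trans (le_of_eq ?_) (linearMutualInfo_le_concurrenceOfAssistance hψ hAB)
    rw [linearMutualInfo, linearMutualInfo, Finset.union_comm]
    ring
  have hBi : ∑ i ∈ ({A, B} : Finset ι)ᶜ, linearMutualInfo ψ {B} {i}
      ≤ ∑ i ∈ ({A, B} : Finset ι)ᶜ, concurrenceOfAssistance (pairState ψ B i) ^ 2 := by
    refine Finset.sum_le_sum fun i hi => linearMutualInfo_le_concurrenceOfAssistance hψ ?_
    rintro rfl
    simp at hi
  rw [Finset.sum_add_distrib]
  linarith

/-- Monogamy for the qubit `C`, with the two-qubit states taken in either order. -/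
theorem exists_mixedConcurrence_sq_le {ψ : (ι → Fin 2) → ℂ}
    (hψ : ∑ x, ψ x * star (ψ x) = 1) (C : ι) :
    ∃ t : ι → ℝ, (∀ j ≠ C, mixedConcurrence (pairState ψ C j) ^ 2 ≤ t j
        ∧ mixedConcurrence (pairState ψ j C) ^ 2 ≤ t j) ∧
      ∑ j ∈ ({C} : Finset ι)ᶜ, t j ≤ 2 * (1 - marginalPurity ψ {C}) := by
  obtain ⟨c, hc, hle⟩ := exists_monogamous_decompositions C {C}ᶜ (by simp) ψ
  rw [four_mul_det_siteState hψ] at hle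
  refine ⟨fun j => c j ^ 2, fun j hj => ⟨?_, ?_⟩, hle⟩
  · exact pow_le_pow_left₀ (mixedConcurrence_nonneg _)
      ((hc j (by simpa using hj)).2.mixedConcurrence_le (by rw [trace_pairState, hψ])) 2
  · have h := (hc j (by simpa using hj)).2.swap
    rw [pairState_swap ψ hj.symm] at h
    exact pow_le_pow_left₀ (mixedConcurrence_nonneg _)
      (h.mixedConcurrence_le (by rw [trace_pairState, hψ])) 2

end Register

/-! ### Bipartite views of a register, and the final inequalities. -/

theorem piecewise_piEquivPiSubtypeProd_symm {N : ℕ} (S : Finset (Fin N))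
    (u v : ({i // i ∈ S} → Fin 2) × ({i // i ∉ S} → Fin 2)) :
    S.piecewise ((Equiv.piEquivPiSubtypeProd (fun i => i ∈ S) (fun _ => Fin 2)).symm u)
      ((Equiv.piEquivPiSubtypeProd (fun i => i ∈ S) (fun _ => Fin 2)).symm v)
      = (Equiv.piEquivPiSubtypeProd (fun i => i ∈ S) (fun _ => Fin 2)).symm (u.1, v.2) := by
  ext i
  by_cases h : i ∈ S <;> simp [Finset.piecewise, Equiv.piEquivPiSubtypeProd, h]

theorem cutConcurrence_sq {N : ℕ} (S : Finset (Fin N)) {ψ : QubitVector N} (hψ : ‖ψ‖ = 1) :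
    cutConcurrence S ψ ^ 2 = 2 * (1 - marginalPurity ψ S) := by
  have h1 : ∑ x, ψ x * star (ψ x) = 1 := by
    rw [EuclideanSpace.sum_mul_star_eq, hψ]; simp
  -- `Real.sqrt` is `0` at negative arguments; purity at most one excludes them.
  have hle := marginalPurity_le_empty ψ S
  rw [marginalPurity_empty h1] at hle
  set e := Equiv.piEquivPiSubtypeProd (fun i => i ∈ S) (fun _ => Fin 2) with he
  have h2 : (Matrix.trace (traceOutRight (pureDensity (bipartiteView S ψ))
      * traceOutRight (pureDensity (bipartiteView S ψ)))).re = marginalPurity ψ S := by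
    rw [marginalPurity_eq_sum]
    congr 1
    rw [← Equiv.sum_comp e.symm]
    have h3 : ∀ u, ∑ y, ψ (e.symm u) * ψ y * star (ψ (S.piecewise y (e.symm u))
          * ψ (S.piecewise (e.symm u) y))
        = ∑ v, ψ (e.symm u) * ψ (e.symm v) * star (ψ (e.symm (v.1, u.2))
          * ψ (e.symm (u.1, v.2))) := by
      intro u
      rw [← Equiv.sum_comp e.symm]
      simp only [he, piecewise_piEquivPiSubtypeProd_symm]
    simp only [h3]
    simp only [Fintype.sum_prod_type, Matrix.trace, Matrix.diag_apply, Matrix.mul_apply,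
      traceOutRight, pureDensity, Matrix.of_apply, bipartiteView, Finset.sum_mul_sum, star_mul']
    refine Finset.sum_congr rfl fun a _ => ?_
    rw [Finset.sum_comm]
    refine Finset.sum_congr rfl fun b _ => ?_
    refine Finset.sum_congr rfl fun a' _ => ?_
    refine Finset.sum_congr rfl fun b' _ => ?_
    ring
  rw [cutConcurrence, pureConcurrence, h2, Real.sq_sqrt (by linarith)]

theorem pairDensity_eq_pairState {N : ℕ} {i j : Fin N} (hij : i ≠ j) (ψ : QubitVector N) :
    pairDensity i j ψ = pairState ψ i j := by
  set S : Finset (Fin N) := {i, j} with hS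
  set e := Equiv.piEquivPiSubtypeProd (fun k => k ∈ S) (fun _ => Fin 2) with he
  have hup : ∀ (p : Fin 2 × Fin 2) u, Function.update (Function.update (e.symm u) i p.1) j p.2
      = e.symm (pairBits i j p, u.2) := by
    intro p u
    ext k
    by_cases hj : k = j
    · subst hj; simp [he, hS, Equiv.piEquivPiSubtypeProd, pairBits, hij.symm]
    · by_cases hi : k = i
      · subst hi; simp [he, hS, Equiv.piEquivPiSubtypeProd, pairBits, hij]
      · simp [he, hS, Equiv.piEquivPiSubtypeProd, hi, hj]
  -- The four values of the overwritten pair of bits cancel the factor `1/4` of `pairState`.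
  have hcard : Fintype.card ({k // k ∈ S} → Fin 2) = 4 := by
    rw [Fintype.card_fun, Fintype.card_fin, Fintype.card_coe, hS, Finset.card_pair hij]
    norm_num
  ext p q
  simp only [pairDensity, reducedDensity, traceOutRight, pureDensity, bipartiteView, pairState,
    Matrix.submatrix_apply, Matrix.of_apply]
  rw [← Equiv.sum_comp e.symm]
  simp only [hup, Fintype.sum_prod_type, Finset.sum_const, Finset.card_univ, hcard]
  rw [nsmul_eq_mul]
  push_cast
  ring_nf
  rfl

theorem corollary2 (N : ℕ) (A B C₁ : Fin N) (hAB : A ≠ B) (hAC : A ≠ C₁) (hBC : B ≠ C₁)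
    (ψ : QubitVector N) (hψ : ‖ψ‖ = 1) :
    (mixedConcurrence (pairDensity A C₁ ψ) ^ 2 + mixedConcurrence (pairDensity B C₁ ψ) ^ 2
          + ∑ i ∈ ({A, B, C₁} : Finset (Fin N))ᶜ, mixedConcurrence (pairDensity C₁ i ψ) ^ 2
          - 2 * concurrenceOfAssistance (pairDensity A B ψ) ^ 2
          - ∑ i ∈ ({A, B} : Finset (Fin N))ᶜ,
              (concurrenceOfAssistance (pairDensity A i ψ) ^ 2
                + concurrenceOfAssistance (pairDensity B i ψ) ^ 2)
        ≤ cutConcurrence {A, B, C₁} ψ ^ 2) ∧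
    (cutConcurrence {A, B, C₁} ψ ^ 2
        ≤ 2 * concurrenceOfAssistance (pairDensity A B ψ) ^ 2
          + ∑ i ∈ ({A, B} : Finset (Fin N))ᶜ,
              (concurrenceOfAssistance (pairDensity A i ψ) ^ 2
                + concurrenceOfAssistance (pairDensity B i ψ) ^ 2)
          + ∑ j ∈ ({C₁} : Finset (Fin N))ᶜ, concurrenceOfAssistance (pairDensity C₁ j ψ) ^ 2) := by
  have h1 : ∑ x, ψ x * star (ψ x) = 1 := by
    rw [EuclideanSpace.sum_mul_star_eq, hψ]; simp
  have hempty := marginalPurity_empty h1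
  have hsumAB : ∑ i ∈ ({A, B} : Finset (Fin N))ᶜ,
      (concurrenceOfAssistance (pairDensity A i ψ) ^ 2
        + concurrenceOfAssistance (pairDensity B i ψ) ^ 2)
      = ∑ i ∈ ({A, B} : Finset (Fin N))ᶜ,
      (concurrenceOfAssistance (pairState ψ A i) ^ 2
        + concurrenceOfAssistance (pairState ψ B i) ^ 2) := by
    refine Finset.sum_congr rfl fun i hi => ?_
    simp only [Finset.mem_compl, Finset.mem_insert, Finset.mem_singleton, not_or] at hi
    rw [pairDensity_eq_pairState (Ne.symm hi.1), pairDensity_eq_pairState (Ne.symm hi.2)]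
  have hassist := linearEntropy_add_le_sum_concurrenceOfAssistance h1 hAB
  have hABsub := marginalPurity_add_le (ψ : (Fin N → Fin 2) → ℂ) (S := {A}) (T := {B})
    (by simpa using hAB)
  have hunion : ({A} ∪ {B} ∪ {C₁} : Finset (Fin N)) = {A, B, C₁} := by
    ext k; simp
  have hdisj : Disjoint ({A} ∪ {B} : Finset (Fin N)) {C₁} := by
    simp [hAC.symm, hBC.symm]
  rw [cutConcurrence_sq _ hψ, hsumAB, pairDensity_eq_pairState hAB]
  constructor
  · obtain ⟨t, ht, hle⟩ := exists_mixedConcurrence_sq_le h1 C₁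
    have hsplit : ({C₁} : Finset (Fin N))ᶜ = insert A (insert B ({A, B, C₁} : Finset (Fin N))ᶜ) := by
      ext k
      by_cases hkA : k = A
      · simp [hkA, hAC]
      · by_cases hkB : k = B
        · simp [hkB, hBC]
        · simp [hkA, hkB]
    rw [hsplit, Finset.sum_insert (by simp [hAB]), Finset.sum_insert (by simp)] at hle
    have hsum : ∑ i ∈ ({A, B, C₁} : Finset (Fin N))ᶜ, mixedConcurrence (pairDensity C₁ i ψ) ^ 2
        ≤ ∑ i ∈ ({A, B, C₁} : Finset (Fin N))ᶜ, t i := by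
      refine Finset.sum_le_sum fun i hi => ?_
      simp only [Finset.mem_compl, Finset.mem_insert, Finset.mem_singleton, not_or] at hi
      rw [pairDensity_eq_pairState (Ne.symm hi.2.2)]
      exact (ht i hi.2.2).1
    -- Passing to complements turns this instance into `T(C₁) ≤ T(AB) + T(ABC₁)`, which becomes the
    -- lower bound after `T(AB) ≤ T(A) + T(B)` and monogamy at `C₁`.
    have hcut := marginalPurity_add_le (ψ : (Fin N → Fin 2) → ℂ) (S := {A} ∪ {B})
      (T := ({A} ∪ {B} ∪ {C₁})ᶜ)
      (disjoint_compl_right.mono_left Finset.subset_union_left)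
    have hcompl : ({A} ∪ {B} ∪ ({A} ∪ {B} ∪ {C₁})ᶜ : Finset (Fin N)) = {C₁}ᶜ := by
      rw [hunion, hsplit]
      ext k
      simp
    rw [hcompl, marginalPurity_compl, marginalPurity_compl, hunion] at hcut
    rw [pairDensity_eq_pairState hAC, pairDensity_eq_pairState hBC]
    linarith [(ht A hAC).2, (ht B hBC).2]
  · have hC := linearEntropy_le_sum_concurrenceOfAssistance h1 C₁
    have hsumC : ∑ j ∈ ({C₁} : Finset (Fin N))ᶜ,
        concurrenceOfAssistance (pairDensity C₁ j ψ) ^ 2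
        = ∑ j ∈ ({C₁} : Finset (Fin N))ᶜ, concurrenceOfAssistance (pairState ψ C₁ j) ^ 2 := by
      refine Finset.sum_congr rfl fun j hj => ?_
      rw [pairDensity_eq_pairState]
      rintro rfl
      simp at hj
    have hcut := marginalPurity_add_le (ψ : (Fin N → Fin 2) → ℂ) hdisj
    rw [hunion] at hcut
    rw [hsumC]
    linarith
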